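/- Let $K\subset\mathbb{R}^n$ be a symmetric convex body, i.e. a compact convex set with nonempty interior such that $-x\in K$ whenever $x\in K$. Let $\|\cdot\|_K$ be the norm with unit ball $K$, let $B(x,t)=\{y\in\mathbb{R}^n:\|y-x\|_K\le t\}$ for $(x,t)$ in the upper half-space $\mathbb{R}^{n+1}_+=\mathbb{R}^n\times(0,\infty)$ (these sets are called $K$-balls), and for $x\in\mathbb{R}^n$ let $$\Gamma_x=\{(y,t)\in\mathbb{R}^{n+1}_+:\ \|x-y\|_K\le t\}.$$ Scalars are real or complex. Let $S^1(K)$ be the normed space of all continuous functions $f$ on $\mathbb{R}^{n+1}_+$ with $$\|f\|_{S^1(K)}=\sup_{\mathcal C}\ \sum_{B(x,t)\in\mathcal C}|f(x,t)|<\infty,$$ where the supremum is over all finite collections $\mathcal C$ of pairwise disjoint $K$-balls, and let $S^1_0(K)$ be the closure in $S^1(K)$ of the space $C_c(\mathbb{R}^{n+1}_+)$ of continuous functions with compact support. Let $T^1(K)$ be the space of all (signed or complex) Radon measures $\mu$ on $\mathbb{R}^{n+1}_+$, possibly of infinite total variation, with $$\|\mu\|_{T^1(K)}=\operatorname*{ess\,sup}_{x\in\mathbb{R}^n}|\mu|(\Gamma_x)<\infty,$$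 where $|\mu|$ is the total variation measure of $\mu$. **Theorem.** For every symmetric convex body $K\subset\mathbb{R}^n$, the space $T^1(K)$ is the dual of $S^1_0(K)$. More precisely, there is a constant $c>0$ depending only on $n$ such that the following holds. For every $\mu\in T^1(K)$ and $f\in S^1_0(K)$ the integral $\int f\,d\mu$ converges absolutely, and $l_\mu(f)=\int_{\mathbb{R}^{n+1}_+} f\,d\mu$ defines a bounded linear functional $l_\mu$ on $S^1_0(K)$ with $$c^{-1}\|\mu\|_{T^1(K)}\le\|l_\mu\|_{S^1_0(K)^*}\le c\,\|\mu\|_{T^1(K)}.$$ Conversely, for every bounded linear functional $l$ on $S^1_0(K)$ there is a unique $\mu\in T^1(K)$ with $l=l_\mu$. The correspondence $\mu\mapsto l_\mu$ is linear. -/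

import Mathlib

open MeasureTheory Filter Topology TopologicalSpace
open scoped ENNReal

noncomputable section

namespace TentSpace

/-! ### Radon measures with real or complex values -/

section Radon

variable {X : Type*} [TopologicalSpace X] [MeasurableSpace X]

/-- The space of `𝕜`-valued (signed or complex) Radon measures on `X`, as set functions on the
relatively compact Borel sets: `μ` is countably additive on every sequence of disjoint Borel sets
with relatively compact union. The total variation may be infinite, so `μ E` is
meaningful for relatively compact Borel sets `E` only; the value at all other sets is fixed to
be `0`, so that two measures are equal iff they agree on all relatively compact Borel sets.
(On the half-space, a `σ`-compact locally compact metrizable space, such a measure is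
automatically inner and outer regular on each compact set.) -/
def radonSubmodule (X : Type*) [TopologicalSpace X] [MeasurableSpace X] (𝕜 : Type*) [RCLike 𝕜] :
    Submodule 𝕜 (Set X → 𝕜) where
  carrier := {μ | (∀ E, ¬ (MeasurableSet E ∧ IsCompact (closure E)) → μ E = 0) ∧
    ∀ F : ℕ → Set X, (∀ i, MeasurableSet (F i)) → Pairwise (Function.onFun Disjoint F) →
      IsCompact (closure (⋃ i, F i)) → HasSum (fun i => μ (F i)) (μ (⋃ i, F i))}
  add_mem' := by
    rintro a b ⟨ha, ha'⟩ ⟨hb, hb'⟩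
    refine ⟨fun E hE => by simp [ha E hE, hb E hE], fun F h1 h2 h3 => ?_⟩
    exact (ha' F h1 h2 h3).add (hb' F h1 h2 h3)
  zero_mem' := ⟨fun _ _ => rfl, fun _ _ _ _ => hasSum_zero⟩
  smul_mem' := by
    rintro c a ⟨ha, ha'⟩
    refine ⟨fun E hE => by simp [ha E hE], fun F h1 h2 h3 => ?_⟩
    exact (ha' F h1 h2 h3).const_smul c

/-- The type of `𝕜`-valued Radon measures on `X`. -/
def RadonMeasure (X : Type*) [TopologicalSpace X] [MeasurableSpace X] (𝕜 : Type*) [RCLike 𝕜] :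
    Type _ := radonSubmodule X 𝕜

namespace RadonMeasure

variable {𝕜 : Type*} [RCLike 𝕜]

instance : AddCommGroup (RadonMeasure X 𝕜) := inferInstanceAs (AddCommGroup (radonSubmodule X 𝕜))

instance : Module 𝕜 (RadonMeasure X 𝕜) := inferInstanceAs (Module 𝕜 (radonSubmodule X 𝕜))

theorem add_apply (μ ν : RadonMeasure X 𝕜) (E : Set X) : (μ + ν).1 E = μ.1 E + ν.1 E := rfl

theorem smul_apply (c : 𝕜) (μ : RadonMeasure X 𝕜) (E : Set X) : (c • μ).1 E = c * μ.1 E := rfl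

theorem zero_apply (E : Set X) : (0 : RadonMeasure X 𝕜).1 E = 0 := rfl

theorem apply_empty (μ : RadonMeasure X 𝕜) : μ.1 ∅ = 0 := by
  have h := μ.2.2 (fun _ => ∅) (fun _ => MeasurableSet.empty)
    (fun _ _ _ => Set.disjoint_empty _) (by simp)
  have h2 := h.summable.tendsto_atTop_zero
  exact tendsto_nhds_unique tendsto_const_nhds h2

variable [T2Space X] [BorelSpace X]

open Classical in
/-- The restriction `E ↦ μ (E ∩ C)` of `μ` to a compact set `C`, a `𝕜`-valued measure on `X`. -/
def restr (μ : RadonMeasure X 𝕜) (C : Compacts X) : VectorMeasure X 𝕜 where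
  measureOf' E := if MeasurableSet E then μ.1 (E ∩ C) else 0
  empty' := by simp [apply_empty]
  not_measurable' E hE := by simp [hE]
  m_iUnion' F hF hd := by
    simp only [hF, MeasurableSet.iUnion hF, if_true, Set.iUnion_inter]
    refine μ.2.2 (fun i => F i ∩ C) (fun i => (hF i).inter C.isCompact.measurableSet)
      (fun i j hij => (hd hij).mono Set.inter_subset_left Set.inter_subset_left) ?_
    exact C.isCompact.closure_of_subset (Set.iUnion_subset fun i => Set.inter_subset_right)

theorem restr_apply (μ : RadonMeasure X 𝕜) (C : Compacts X) {E : Set X} (hE : MeasurableSet E) :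
    μ.restr C E = μ.1 (E ∩ C) := if_pos hE

theorem restr_add (μ ν : RadonMeasure X 𝕜) (C : Compacts X) :
    (μ + ν).restr C = μ.restr C + ν.restr C := by
  ext E hE
  simp [restr_apply, hE, add_apply]

theorem restr_smul (c : 𝕜) (μ : RadonMeasure X 𝕜) (C : Compacts X) :
    (c • μ).restr C = c • μ.restr C := by
  ext E hE
  simp [restr_apply, hE, smul_apply]

theorem variation_restr_mono (μ : RadonMeasure X 𝕜) :
    Monotone fun C : Compacts X => (μ.restr C).variation := by
  intro C D hCD
  have hC : MeasurableSet (C : Set X) := C.isCompact.measurableSet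
  have h : μ.restr C = (μ.restr D).restrict C := by
    ext E hE
    rw [VectorMeasure.restrict_apply _ hC hE, restr_apply _ _ hE, restr_apply _ _ (hE.inter hC),
      Set.inter_assoc, Set.inter_eq_left.2 (show (C : Set X) ⊆ D from hCD)]
  simp only [h]
  exact VectorMeasure.variation_restrict_le.trans Measure.restrict_le_self

/-- The total variation measure `|μ|`, with `|μ|(E) = sup_C |μ restricted to C|(E)`, the supremum
over all compact sets `C`. -/
def variation (μ : RadonMeasure X 𝕜) : Measure X :=
  Measure.ofMeasurable (fun E _ => ⨆ C : Compacts X, (μ.restr C).variation E) (by simp) (by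
    intro F hF hd
    simp only [measure_iUnion hd hF, ENNReal.tsum_eq_iSup_sum]
    rw [iSup_comm]
    congr 1
    ext s
    rw [ENNReal.finsetSum_iSup_of_monotone]
    exact fun i C D hCD => variation_restr_mono μ hCD (F i))

theorem variation_apply (μ : RadonMeasure X 𝕜) {E : Set X} (hE : MeasurableSet E) :
    μ.variation E = ⨆ C : Compacts X, (μ.restr C).variation E :=
  Measure.ofMeasurable_apply E hE

theorem variation_add_le (μ ν : RadonMeasure X 𝕜) :
    (μ + ν).variation ≤ μ.variation + ν.variation := by
  refine Measure.le_iff.2 fun E hE => ?_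
  simp only [Measure.add_apply, variation_apply _ hE]
  refine iSup_le fun C => ?_
  rw [restr_add]
  refine (VectorMeasure.variation_add_le (μ := μ.restr C) (ν := ν.restr C) E).trans ?_
  exact add_le_add (le_iSup (fun C => (μ.restr C).variation E) C)
    (le_iSup (fun C => (ν.restr C).variation E) C)

theorem variation_smul_le (c : 𝕜) (μ : RadonMeasure X 𝕜) :
    (c • μ).variation ≤ ‖c‖₊ • μ.variation := by
  refine Measure.le_iff.2 fun E hE => ?_
  rw [Measure.smul_apply, variation_apply _ hE, variation_apply _ hE]
  refine iSup_le fun C => ?_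
  rw [restr_smul, VectorMeasure.variation_smul, Measure.smul_apply]
  gcongr
  exact le_iSup (fun C => (μ.restr C).variation E) C

/-- `HasIntegral μ f I`: the integral of `f` with respect to `μ` converges absolutely
(`f` is integrable for `|μ|`) and has the value `I`, which is the limit of the integrals over
compact sets `C`, as `C` increases to the whole space. -/
def HasIntegral (μ : RadonMeasure X 𝕜) (f : X → 𝕜) (I : 𝕜) : Prop :=
  Integrable f μ.variation ∧
    Tendsto (fun C : Compacts X => ∫ᵛ x, f x ∂[ContinuousLinearMap.mul ℝ 𝕜; μ.restr C])
      atTop (𝓝 I)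

end RadonMeasure

end Radon

/-! ### `K`-balls and cones -/

/-- The upper half-space `ℝⁿ × (0, ∞)`. -/
abbrev HalfSpace (n : ℕ) : Type := EuclideanSpace ℝ (Fin n) × Set.Ioi (0 : ℝ)

variable {n : ℕ}

/-- The closed ball of center `p.1` and radius `p.2` for the norm with unit ball `K`. -/
def kBall (K : Set (EuclideanSpace ℝ (Fin n))) (p : HalfSpace n) : Set (EuclideanSpace ℝ (Fin n)) :=
  {y | gauge K (y - p.1) ≤ p.2}

/-- The cone `Γ_x` with base `K` and vertex `x`. -/
def cone (K : Set (EuclideanSpace ℝ (Fin n))) (x : EuclideanSpace ℝ (Fin n)) : Set (HalfSpace n) :=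
  {p | gauge K (x - p.1) ≤ p.2}

/-! ### The spaces `S¹(K)` and `S¹₀(K)` -/

section S1

variable {𝕜 : Type*} [RCLike 𝕜]

/-- The supremum of `∑_{B ∈ C} |f_B|` over all finite collections `C` of pairwise disjoint
`K`-balls. -/
def s1ENorm (K : Set (EuclideanSpace ℝ (Fin n))) (f : HalfSpace n → 𝕜) : ℝ≥0∞ :=
  ⨆ (C : Finset (HalfSpace n)) (_ : (C : Set (HalfSpace n)).PairwiseDisjoint (kBall K)),
    ∑ p ∈ C, ‖f p‖ₑ

variable (K : Set (EuclideanSpace ℝ (Fin n)))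

theorem s1ENorm_add_le (f g : HalfSpace n → 𝕜) :
    s1ENorm K (f + g) ≤ s1ENorm K f + s1ENorm K g := by
  refine iSup₂_le fun C hC => ?_
  calc ∑ p ∈ C, ‖(f + g) p‖ₑ ≤ ∑ p ∈ C, (‖f p‖ₑ + ‖g p‖ₑ) :=
        Finset.sum_le_sum fun p _ => enorm_add_le _ _
    _ = ∑ p ∈ C, ‖f p‖ₑ + ∑ p ∈ C, ‖g p‖ₑ := Finset.sum_add_distrib
    _ ≤ _ := add_le_add
        (le_iSup₂ (f := fun (C : Finset (HalfSpace n))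
          (_ : (C : Set (HalfSpace n)).PairwiseDisjoint (kBall K)) => ∑ p ∈ C, ‖f p‖ₑ) C hC)
        (le_iSup₂ (f := fun (C : Finset (HalfSpace n))
          (_ : (C : Set (HalfSpace n)).PairwiseDisjoint (kBall K)) => ∑ p ∈ C, ‖g p‖ₑ) C hC)

theorem s1ENorm_zero : s1ENorm K (0 : HalfSpace n → 𝕜) = 0 := by
  simp [s1ENorm]

theorem s1ENorm_smul (c : 𝕜) (f : HalfSpace n → 𝕜) :
    s1ENorm K (c • f) = ‖c‖ₑ * s1ENorm K f := by
  simp only [s1ENorm, Pi.smul_apply, smul_eq_mul, enorm_mul, ENNReal.mul_iSup, Finset.mul_sum]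

theorem enorm_le_s1ENorm (f : HalfSpace n → 𝕜) (p : HalfSpace n) : ‖f p‖ₑ ≤ s1ENorm K f := by
  refine le_iSup₂_of_le {p} (by simp) ?_
  simp

variable (𝕜)

/-- The continuous functions on the half-space with finite `S¹(K)`-norm. -/
def s1Submodule : Submodule 𝕜 C(HalfSpace n, 𝕜) where
  carrier := {f | s1ENorm K f < ∞}
  add_mem' {f g} hf hg := (s1ENorm_add_le K f g).trans_lt (ENNReal.add_lt_top.2 ⟨hf, hg⟩)
  zero_mem' := by simp [s1ENorm_zero]
  smul_mem' c f hf := by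
    change s1ENorm K (c • (f : HalfSpace n → 𝕜)) < ∞
    rw [s1ENorm_smul]
    exact ENNReal.mul_lt_top enorm_lt_top hf

/-- The space `S¹(K)`, as a type of its own: it carries the norm `‖·‖_{S¹(K)}`, and not the
compact-open topology of the space of all continuous functions. -/
def S1 : Type _ := s1Submodule 𝕜 K

instance : AddCommGroup (S1 𝕜 K) := inferInstanceAs (AddCommGroup (s1Submodule 𝕜 K))

instance : Module 𝕜 (S1 𝕜 K) := inferInstanceAs (Module 𝕜 (s1Submodule 𝕜 K))

instance : CoeFun (S1 𝕜 K) (fun _ => HalfSpace n → 𝕜) := ⟨fun f => f.1⟩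

instance : Norm (S1 𝕜 K) := ⟨fun f => (s1ENorm K f).toReal⟩

theorem S1.norm_def (f : S1 𝕜 K) : ‖f‖ = (s1ENorm K f).toReal := rfl

theorem S1.core : NormedSpace.Core 𝕜 (S1 𝕜 K) where
  norm_nonneg f := ENNReal.toReal_nonneg
  norm_smul c f := by
    change (s1ENorm K (c • (f : HalfSpace n → 𝕜))).toReal = _
    rw [s1ENorm_smul, ENNReal.toReal_mul, toReal_enorm, S1.norm_def]
  norm_triangle f g := by
    have h := s1ENorm_add_le K (f : HalfSpace n → 𝕜) g
    have h2 := ENNReal.toReal_mono (ENNReal.add_ne_top.2 ⟨f.2.ne, g.2.ne⟩) h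
    rwa [ENNReal.toReal_add f.2.ne g.2.ne] at h2
  norm_eq_zero_iff f := by
    constructor
    · intro h
      have h0 : s1ENorm K f = 0 := ((ENNReal.toReal_eq_zero_iff _).1 h).resolve_right f.2.ne
      refine Subtype.ext (ContinuousMap.ext fun p => ?_)
      have h1 := enorm_le_s1ENorm K f p
      rw [h0, nonpos_iff_eq_zero, enorm_eq_zero] at h1
      exact h1
    · rintro rfl
      change (s1ENorm K (0 : HalfSpace n → 𝕜)).toReal = 0
      rw [s1ENorm_zero, ENNReal.toReal_zero]

instance : NormedAddCommGroup (S1 𝕜 K) := NormedAddCommGroup.ofCore (S1.core 𝕜 K)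

instance : NormedSpace 𝕜 (S1 𝕜 K) := NormedSpace.ofCore (S1.core 𝕜 K)

/-- The compactly supported functions in `S¹(K)`. By `mem_s1Submodule_of_hasCompactSupport`
these are all the continuous compactly supported functions on the half-space. -/
def ccSubmodule : Submodule 𝕜 (S1 𝕜 K) where
  carrier := {f | HasCompactSupport f}
  add_mem' {f _} hf hg := HasCompactSupport.add (f := (f : HalfSpace n → 𝕜)) hf hg
  zero_mem' := HasCompactSupport.zero
  smul_mem' c f hf := HasCompactSupport.smul_left (f := fun _ => c) (f' := (f : HalfSpace n → 𝕜)) hf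

/-- The space `S¹₀(K)`: the closure of `C_c` in `S¹(K)`. -/
def S10 : Submodule 𝕜 (S1 𝕜 K) := (ccSubmodule 𝕜 K).topologicalClosure

end S1

/-- For a symmetric convex body `K`, all of `C_c` is contained in `S¹(K)`. -/
theorem mem_s1Submodule_of_hasCompactSupport {𝕜 : Type*} [RCLike 𝕜]
    (K : ConvexBody (EuclideanSpace ℝ (Fin n)))
    (hK : (interior (K : Set (EuclideanSpace ℝ (Fin n)))).Nonempty) (hsymm : ∀ x ∈ K, -x ∈ K)
    (f : C(HalfSpace n, 𝕜)) (hf : HasCompactSupport f) :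
    f ∈ s1Submodule 𝕜 (K : Set (EuclideanSpace ℝ (Fin n))) := by
  set S : Set (EuclideanSpace ℝ (Fin n)) := (K : Set (EuclideanSpace ℝ (Fin n))) with hS
  have hconv : Convex ℝ S := K.convex
  have hs' : ∀ x ∈ S, -x ∈ S := hsymm
  have h0 : S ∈ 𝓝 0 := by
    obtain ⟨x, hx⟩ := hK
    have hneg : -x ∈ interior S := by
      have h1 : -S = S := by
        ext y
        exact ⟨fun hy => by simpa using hs' _ hy, fun hy => hs' _ hy⟩
      have h3 : -interior S = interior S := by
        have h4 := (Homeomorph.neg (EuclideanSpace ℝ (Fin n))).preimage_interior S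
        change -interior S = interior (-S) at h4
        rw [h4, h1]
      rw [← h3]
      simpa using hx
    have h2 : (0 : EuclideanSpace ℝ (Fin n)) ∈ interior S := by
      have := hconv.interior hx hneg (by norm_num : (0 : ℝ) ≤ 1 / 2)
        (by norm_num : (0 : ℝ) ≤ 1 / 2) (by norm_num)
      simpa using this
    exact mem_interior_iff_mem_nhds.1 h2
  have hcont : Continuous (gauge S) := continuous_gauge hconv h0
  have habs : Absorbent ℝ S := absorbent_nhds_zero h0
  obtain ⟨a, ha, haF⟩ : ∃ a : ℝ, 0 < a ∧ ∀ p ∈ tsupport f, a ≤ (p.2 : ℝ) := by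
    rcases (tsupport f).eq_empty_or_nonempty with h | h
    · exact ⟨1, one_pos, by simp [h]⟩
    · obtain ⟨p, hp, hmin⟩ := hf.isCompact.exists_isMinOn h
        (f := fun p : HalfSpace n => (p.2 : ℝ)) (by fun_prop)
      exact ⟨p.2, p.2.2, fun q hq => hmin hq⟩
  obtain ⟨M, hM⟩ : ∃ M : ℝ, ∀ p, ‖f p‖ ≤ M := hf.exists_bound_of_continuous f.continuous
  have hcomp : IsCompact (Prod.fst '' tsupport f) := hf.isCompact.image continuous_fst
  obtain ⟨J, -, hJ⟩ := hcomp.elim_nhds_subcover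
    (fun z => {y : EuclideanSpace ℝ (Fin n) | gauge S (y - z) < a / 2}) (by
      intro z _
      refine IsOpen.mem_nhds (isOpen_lt (hcont.comp (by fun_prop)) continuous_const) ?_
      simp [ha])
  have hchoice : ∀ p : HalfSpace n, ∃ z, p ∈ tsupport f → z ∈ J ∧ gauge S (p.1 - z) < a / 2 := by
    intro p
    by_cases hp : p ∈ tsupport f
    · have := hJ ⟨p, hp, rfl⟩
      simp only [Set.mem_iUnion, Set.mem_ofPred_eq, exists_prop] at this
      obtain ⟨z, hz⟩ := this
      exact ⟨z, fun _ => hz⟩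
    · exact ⟨0, fun h => absurd h hp⟩
  choose z hz using hchoice
  have hbound : s1ENorm S (f : HalfSpace n → 𝕜) ≤ J.card * ENNReal.ofReal M := by
    refine iSup₂_le fun C hC => ?_
    classical
    have hsum : ∑ p ∈ C, ‖f p‖ₑ = ∑ p ∈ C with p ∈ tsupport f, ‖f p‖ₑ := by
      refine (Finset.sum_filter_of_ne fun p _ hp => ?_).symm
      exact subset_tsupport _ (by simpa using hp)
    have hcard : (C.filter (· ∈ tsupport f)).card ≤ J.card := by
      refine Finset.card_le_card_of_injOn z (fun p hp => ?_) (fun p hp q hq hpq => ?_)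
      · exact (hz p (Finset.mem_filter.1 hp).2).1
      · have hp' := Finset.mem_filter.1 hp
        have hq' := Finset.mem_filter.1 hq
        by_contra hne
        refine Set.disjoint_left.1 (hC hp'.1 hq'.1 hne) (?_ : p.1 ∈ kBall S p) ?_
        · simpa [kBall] using p.2.2.le
        · have h1 := (hz p hp'.2).2
          have h2 := (hz q hq'.2).2
          have h3 := gauge_add_le hconv habs (p.1 - z p) (z p - q.1)
          have h4 : gauge S (z p - q.1) = gauge S (q.1 - z q) := by
            rw [hpq, ← neg_sub, gauge_neg hs']
          rw [sub_add_sub_cancel] at h3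
          have h5 := haF q hq'.2
          change gauge S (p.1 - q.1) ≤ q.2
          linarith
    rw [hsum]
    calc ∑ p ∈ C with p ∈ tsupport f, ‖f p‖ₑ
        ≤ ∑ p ∈ C with p ∈ tsupport f, ENNReal.ofReal M :=
          Finset.sum_le_sum fun p _ => by
            rw [← ofReal_norm]
            exact ENNReal.ofReal_le_ofReal (hM p)
      _ = (C.filter (· ∈ tsupport f)).card * ENNReal.ofReal M := by simp
      _ ≤ J.card * ENNReal.ofReal M := by gcongr
  exact hbound.trans_lt (ENNReal.mul_lt_top (by simp) ENNReal.ofReal_lt_top)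

/-! ### The space `T¹(K)` -/

section T1

variable {𝕜 : Type*} [RCLike 𝕜] (K : Set (EuclideanSpace ℝ (Fin n)))

/-- The `L^∞(ℝⁿ)`-norm (essential supremum for Lebesgue measure) of `x ↦ |μ|(Γ_x)`. -/
def t1ENorm (μ : RadonMeasure (HalfSpace n) 𝕜) : ℝ≥0∞ :=
  essSup (fun x => μ.variation (cone K x)) volume

theorem t1ENorm_add_le (μ ν : RadonMeasure (HalfSpace n) 𝕜) :
    t1ENorm K (μ + ν) ≤ t1ENorm K μ + t1ENorm K ν := by
  refine le_trans (essSup_mono_ae (Eventually.of_forall fun x => ?_)) (ENNReal.essSup_add_le _ _)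
  exact RadonMeasure.variation_add_le μ ν (cone K x)

theorem t1ENorm_smul_le (c : 𝕜) (μ : RadonMeasure (HalfSpace n) 𝕜) :
    t1ENorm K (c • μ) ≤ ‖c‖ₑ * t1ENorm K μ := by
  rw [t1ENorm, t1ENorm, ← ENNReal.essSup_const_mul]
  refine essSup_mono_ae (Eventually.of_forall fun x => ?_)
  exact RadonMeasure.variation_smul_le c μ (cone K x)

variable (𝕜)

/-- The space `T¹(K)` of all Radon measures `μ` on the half-space with `‖μ‖_{T¹(K)} < ∞`. -/
def T1 : Submodule 𝕜 (RadonMeasure (HalfSpace n) 𝕜) where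
  carrier := {μ | t1ENorm K μ < ∞}
  add_mem' {μ ν} hμ hν := (t1ENorm_add_le K μ ν).trans_lt (ENNReal.add_lt_top.2 ⟨hμ, hν⟩)
  zero_mem' := by
    have h : t1ENorm K (0 : RadonMeasure (HalfSpace n) 𝕜) ≤ 0 := by
      simpa using t1ENorm_smul_le K (0 : 𝕜) (0 : RadonMeasure (HalfSpace n) 𝕜)
    exact h.trans_lt (by simp)
  smul_mem' c μ hμ := (t1ENorm_smul_le K c μ).trans_lt (ENNReal.mul_lt_top enorm_lt_top hμ)

instance : Norm (T1 𝕜 K) := ⟨fun μ => (t1ENorm K μ.1).toReal⟩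

theorem T1.norm_def (μ : T1 𝕜 K) :
    ‖μ‖ = (essSup (fun x => μ.1.variation (cone K x)) volume).toReal := rfl

end T1

end TentSpace

end

/-!
# The dual of `S¹₀(K)` is `T¹(K)`

**Boundedness of `l_μ`.** A measure `|μ|` with `|μ|(Γ_x) ≤ M` for almost every `x` is `M` times a
fractional packing of `K`-balls, while `‖f‖_{S¹(K)}` is the supremum of `∑ |f|` over genuine
packings. The inequality `∫ |f| d|μ| ≤ 8ⁿ M ‖f‖_{S¹(K)}` says that for balls the two notions agree
up to a constant. For finitely many balls this is the local ratio argument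
`sum_mul_le_of_independent_le`, which only needs that the balls meeting a given ball and at least as
large as it have bounded total weight. This bound is `measure_large_near_balls_le`: each of these
balls covers a fixed proportion of a multiple of the given ball, so that Tonelli's theorem bounds
their weight by an average of `|μ|(Γ_x)`. In particular almost everywhere bounds on `|μ|(Γ_x)`
suffice. General measures are discretized on compact sets (`setLIntegral_enorm_le`).

**Surjectivity.** A bounded functional `l` on `S¹₀(K)` restricts to `C_c`, where
`f ↦ sup {|l g| : |g| ≤ f}` is a finite positive linear functional and thus given by a positive
measure `ν`. As `|l g| ≤ ∫ |g| dν`, the functional extends to `L¹(ν)`, and `μ E = l 1_E` is a Radon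
measure with `|μ| ≤ ν` that represents `l` (`exists_radonMeasure_of_orderBounded`). All balls of the
cone `Γ_x` contain `x`, so functions bounded by `1` and supported there have `S¹(K)`-norm at most
`1`; hence the interior of `Γ_x` has `ν`-measure at most `‖l‖`, and by Tonelli's theorem the
boundary of `Γ_x` is `ν`-null for almost every `x`. This gives `‖μ‖_{T¹(K)} ≤ ‖l‖`.

**Injectivity and the lower bound.** Measures in `T¹(K)` have locally finite variation, so `C_c` is
dense in `L¹(|μ|)` and `l_μ = 0` forces `μ = 0`. By uniqueness, the bound `‖μ‖_{T¹(K)} ≤ ‖l‖` for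
the constructed measure holds for every `μ` with `l = l_μ`.
-/

namespace TentSpace

/-! ### Integration with respect to a Radon measure -/

section AgreeOnIndicators

variable {X : Type*} [MeasurableSpace X] {𝕜 : Type*} [RCLike 𝕜]

/-- Two additive functionals on `L¹(ν)` that are Lipschitz for the `L¹`-norm agree as soon as they
agree on multiples of indicators of measurable sets. -/
theorem eq_of_eq_indicator {ν : Measure X} {A B : (X → 𝕜) → 𝕜} (K : NNReal)
    (hA : ∀ f g, Integrable f ν → Integrable g ν → A (f + g) = A f + A g)
    (hB : ∀ f g, Integrable f ν → Integrable g ν → B (f + g) = B f + B g)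
    (hA' : ∀ f g, Integrable f ν → Integrable g ν → ‖A f - A g‖ₑ ≤ K * ∫⁻ x, ‖f x - g x‖ₑ ∂ν)
    (hB' : ∀ f g, Integrable f ν → Integrable g ν → ‖B f - B g‖ₑ ≤ K * ∫⁻ x, ‖f x - g x‖ₑ ∂ν)
    (h : ∀ (c : 𝕜) (s : Set X), MeasurableSet s → ν s < ∞ →
      A (s.indicator fun _ => c) = B (s.indicator fun _ => c))
    {f : X → 𝕜} (hf : Integrable f ν) : A f = B f := by
  have key : ∀ D : (X → 𝕜) → 𝕜, (∀ f g, Integrable f ν → Integrable g ν →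
      ‖D f - D g‖ₑ ≤ K * ∫⁻ x, ‖f x - g x‖ₑ ∂ν) → Continuous fun f : Lp 𝕜 1 ν => D f := by
    intro D hD
    have hL : LipschitzWith K fun f : Lp 𝕜 1 ν => D f := by
      intro f g
      rw [edist_eq_enorm_sub]
      refine (hD f g (L1.integrable_coeFn f) (L1.integrable_coeFn g)).trans ?_
      rw [Lp.edist_def, eLpNorm_one_eq_lintegral_enorm]
      rfl
    exact hL.continuous
  have hcongr : ∀ D : (X → 𝕜) → 𝕜, (∀ f g, Integrable f ν → Integrable g ν →
      ‖D f - D g‖ₑ ≤ K * ∫⁻ x, ‖f x - g x‖ₑ ∂ν) →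
      ∀ f g, f =ᵐ[ν] g → Integrable f ν → D f = D g := by
    intro D hD f g hfg hf
    have h1 := hD f g hf (hf.congr hfg)
    have h2 : ∫⁻ x, ‖f x - g x‖ₑ ∂ν = 0 := by
      rw [lintegral_congr_ae (g := fun _ => 0)]
      · simp
      · filter_upwards [hfg] with x hx
        simp [hx]
    rw [h2, mul_zero, nonpos_iff_eq_zero, enorm_eq_zero, sub_eq_zero] at h1
    exact h1
  refine Integrable.induction (fun f => A f = B f) (fun c s hs hs' => h c s hs hs') ?_ ?_ ?_ hf
  · intro f g _ hf hg h1 h2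
    rw [hA f g hf hg, hB f g hf hg, h1, h2]
  · exact isClosed_eq (key A hA') (key B hB')
  · intro f g hfg hf h1
    rw [← hcongr A hA' f g hfg hf, ← hcongr B hB' f g hfg hf, h1]

end AgreeOnIndicators

namespace RadonMeasure

variable {X : Type*} [TopologicalSpace X] [MeasurableSpace X] [T2Space X] [BorelSpace X]
variable {𝕜 : Type*} [RCLike 𝕜]

theorem restr_eq_restrict (μ : RadonMeasure X 𝕜) {C D : Compacts X} (hCD : C ≤ D) :
    μ.restr C = (μ.restr D).restrict C := by
  have hC : MeasurableSet (C : Set X) := C.isCompact.measurableSet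
  ext E hE
  rw [VectorMeasure.restrict_apply _ hC hE, restr_apply _ _ hE, restr_apply _ _ (hE.inter hC),
    Set.inter_assoc, Set.inter_eq_left.2 (show (C : Set X) ⊆ D from hCD)]

theorem variation_restr_le (μ : RadonMeasure X 𝕜) (C : Compacts X) :
    (μ.restr C).variation ≤ μ.variation.restrict C := by
  have hC : MeasurableSet (C : Set X) := C.isCompact.measurableSet
  refine VectorMeasure.variation_le_of_forall_enorm_le fun E hE => ?_
  rw [Measure.restrict_apply hE, variation_apply _ (hE.inter hC)]
  refine le_trans ?_ (le_iSup _ C)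
  refine le_trans (le_of_eq ?_) (VectorMeasure.enorm_measure_le_variation _ _)
  rw [restr_apply _ _ hE, restr_apply _ _ (hE.inter hC), Set.inter_assoc, Set.inter_self]

/-- A measure bounding `μ` on all relatively compact Borel sets bounds its variation. -/
theorem variation_le (μ : RadonMeasure X 𝕜) {ν : Measure X}
    (h : ∀ E, MeasurableSet E → IsCompact (closure E) → ‖μ.1 E‖ₑ ≤ ν E) : μ.variation ≤ ν := by
  refine Measure.le_iff.2 fun E hE => ?_
  rw [variation_apply _ hE]
  refine iSup_le fun C => VectorMeasure.variation_le_of_forall_enorm_le (fun F hF => ?_) E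
  rw [restr_apply _ _ hF]
  exact (h _ (hF.inter C.isCompact.measurableSet)
    (C.isCompact.closure_of_subset Set.inter_subset_right)).trans
      (measure_mono Set.inter_subset_left)

variable {μ ν : RadonMeasure X 𝕜} {f g : X → 𝕜} {I J : 𝕜}

theorem integrable_restr (hf : Integrable f μ.variation) (C : Compacts X) :
    Integrable f (μ.restr C).variation :=
  hf.mono_measure ((variation_restr_le μ C).trans Measure.restrict_le_self)

theorem enorm_integral_restr_le (μ : RadonMeasure X 𝕜) (f : X → 𝕜) (C : Compacts X) :
    ‖∫ᵛ x, f x ∂[ContinuousLinearMap.mul ℝ 𝕜; μ.restr C]‖ₑ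
      ≤ ∫⁻ x in C, ‖f x‖ₑ ∂μ.variation := by
  refine VectorMeasure.enorm_integral_le_lintegral_enorm.trans ?_
  have h : ‖ContinuousLinearMap.mul ℝ 𝕜‖ₑ ≤ 1 := by
    rw [← ofReal_norm]
    simp
  calc _ ≤ 1 * ∫⁻ x, ‖f x‖ₑ ∂(μ.restr C).variation := by gcongr
    _ ≤ _ := by
      rw [one_mul]
      exact lintegral_mono' (variation_restr_le μ C) le_rfl

theorem enorm_integral_restr_sub_le (hf : Integrable f μ.variation) {C D : Compacts X}
    (hCD : C ≤ D) :
    ‖(∫ᵛ x, f x ∂[ContinuousLinearMap.mul ℝ 𝕜; μ.restr D]) -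
      ∫ᵛ x, f x ∂[ContinuousLinearMap.mul ℝ 𝕜; μ.restr C]‖ₑ
      ≤ ∫⁻ x in (C : Set X)ᶜ, ‖f x‖ₑ ∂μ.variation := by
  have hC : MeasurableSet (C : Set X) := C.isCompact.measurableSet
  rw [restr_eq_restrict μ hCD, ← VectorMeasure.setIntegral_compl hC (integrable_restr hf D),
    ← VectorMeasure.integral_indicator hC.compl]
  refine (enorm_integral_restr_le μ _ D).trans ?_
  refine (lintegral_mono' Measure.restrict_le_self le_rfl).trans ?_
  rw [← lintegral_indicator hC.compl]
  refine lintegral_mono fun x => ?_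
  by_cases hx : x ∈ (C : Set X) <;> simp [hx]

/-- The integral of `f` with respect to `μ`, with a junk value if the limit does not exist. -/
noncomputable def integral (μ : RadonMeasure X 𝕜) (f : X → 𝕜) : 𝕜 :=
  limUnder atTop fun C : Compacts X => ∫ᵛ x, f x ∂[ContinuousLinearMap.mul ℝ 𝕜; μ.restr C]

theorem HasIntegral.integral_eq (h : μ.HasIntegral f I) : μ.integral f = I := h.2.limUnder_eq

theorem exists_compacts_lintegral_compl_lt [SigmaCompactSpace X] {ν : Measure X}
    (hf : Integrable f ν) {ε : ℝ≥0∞} (hε : 0 < ε) :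
    ∃ C : Compacts X, ∫⁻ x in (C : Set X)ᶜ, ‖f x‖ₑ ∂ν < ε := by
  have h1 : ∀ k : ℕ, MeasurableSet (compactCovering X k)ᶜ :=
    fun k => (isCompact_compactCovering X k).measurableSet.compl
  have h2 : Tendsto (fun k : ℕ => (ν.withDensity fun x => ‖f x‖ₑ) (compactCovering X k)ᶜ) atTop
      (𝓝 ((ν.withDensity fun x => ‖f x‖ₑ) (⋂ k, (compactCovering X k)ᶜ))) := by
    refine tendsto_measure_iInter_atTop (fun k => (h1 k).nullMeasurableSet) ?_ ⟨0, ?_⟩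
    · exact fun i j hij => Set.compl_subset_compl.2 (compactCovering_subset X hij)
    · rw [withDensity_apply _ (h1 0)]
      exact ((lintegral_mono' Measure.restrict_le_self le_rfl).trans_lt hf.2).ne
  rw [← Set.compl_iUnion, iUnion_compactCovering, Set.compl_univ, measure_empty] at h2
  obtain ⟨k, hk⟩ := (h2.eventually (gt_mem_nhds hε)).exists
  rw [withDensity_apply _ (h1 k)] at hk
  exact ⟨⟨_, isCompact_compactCovering X k⟩, hk⟩

/-- For an integrable function, the integrals over compact sets form a Cauchy net. -/
theorem exists_hasIntegral [SigmaCompactSpace X] (hf : Integrable f μ.variation) :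
    ∃ I, μ.HasIntegral f I := by
  suffices h : Cauchy (map (fun C : Compacts X =>
      ∫ᵛ x, f x ∂[ContinuousLinearMap.mul ℝ 𝕜; μ.restr C]) atTop) by
    obtain ⟨I, hI⟩ := CompleteSpace.complete h
    exact ⟨I, hf, hI⟩
  refine EMetric.cauchy_iff.2 ⟨map_neBot.ne, fun ε hε => ?_⟩
  obtain ⟨C, hC⟩ := exists_compacts_lintegral_compl_lt hf (ENNReal.half_pos hε.ne')
  refine ⟨_, image_mem_map (Ici_mem_atTop C), ?_⟩
  rintro _ ⟨D, hD, rfl⟩ _ ⟨D', hD', rfl⟩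
  refine (edist_triangle_right _ _
    (∫ᵛ x, f x ∂[ContinuousLinearMap.mul ℝ 𝕜; μ.restr C])).trans_lt ?_
  rw [edist_eq_enorm_sub, edist_eq_enorm_sub]
  calc _ ≤ _ := add_le_add (enorm_integral_restr_sub_le hf hD) (enorm_integral_restr_sub_le hf hD')
    _ < ε / 2 + ε / 2 := ENNReal.add_lt_add hC hC
    _ = ε := ENNReal.add_halves ε

theorem HasIntegral.add (hf : μ.HasIntegral f I) (hg : μ.HasIntegral g J) :
    μ.HasIntegral (f + g) (I + J) := by
  refine ⟨hf.1.add hg.1, (hf.2.add hg.2).congr fun C => ?_⟩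
  exact (VectorMeasure.integral_add (integrable_restr hf.1 C) (integrable_restr hg.1 C)).symm

theorem HasIntegral.smul (c : 𝕜) (hf : μ.HasIntegral f I) : μ.HasIntegral (c • f) (c * I) := by
  refine ⟨hf.1.smul c, (hf.2.const_mul c).congr fun C => ?_⟩
  refine (setToFun_smul (𝕜 := 𝕜) _ (fun c s x => ?_) c f).symm
  exact mul_assoc c x _

theorem HasIntegral.sub (hf : μ.HasIntegral f I) (hg : μ.HasIntegral g J) :
    μ.HasIntegral (f - g) (I - J) := by
  have h := hf.add (hg.smul (-1))
  rwa [neg_one_smul, ← sub_eq_add_neg, neg_one_mul, ← sub_eq_add_neg] at h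

theorem HasIntegral.enorm_le (hf : μ.HasIntegral f I) : ‖I‖ₑ ≤ ∫⁻ x, ‖f x‖ₑ ∂μ.variation :=
  le_of_tendsto hf.2.enorm (Eventually.of_forall fun C =>
    (enorm_integral_restr_le μ f C).trans (lintegral_mono' Measure.restrict_le_self le_rfl))

theorem HasIntegral.add_measure (hf : μ.HasIntegral f I) (hg : ν.HasIntegral f J) :
    (μ + ν).HasIntegral f (I + J) := by
  refine ⟨(hf.1.add_measure hg.1).mono_measure (variation_add_le μ ν),
    (hf.2.add hg.2).congr fun C => ?_⟩
  rw [restr_add]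
  exact (VectorMeasure.integral_add_vectorMeasure (integrable_restr hf.1 C)
    (integrable_restr hg.1 C)).symm

theorem integral_restr_indicator (μ : RadonMeasure X 𝕜) {C : Compacts X} (hC : μ.variation C ≠ ∞)
    (c : 𝕜) {s : Set X} (hs : MeasurableSet s) :
    ∫ᵛ x, s.indicator (fun _ => c) x ∂[ContinuousLinearMap.mul ℝ 𝕜; μ.restr C]
      = c * μ.1 (s ∩ C) := by
  have : IsFiniteMeasure (μ.restr C).variation := by
    refine ⟨(variation_restr_le μ C _).trans_lt ?_⟩
    simpa using hC.lt_top
  rw [VectorMeasure.integral_indicator hs, VectorMeasure.integral_const,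
    VectorMeasure.restrict_apply _ hs MeasurableSet.univ, Set.univ_inter, restr_apply _ _ hs]
  rfl

theorem hasIntegral_indicator (hμ : ∀ C : Compacts X, μ.variation C ≠ ∞) (c : 𝕜) {E : Set X}
    (hE : MeasurableSet E) (hE' : IsCompact (closure E)) :
    μ.HasIntegral (E.indicator fun _ => c) (c * μ.1 E) := by
  constructor
  · refine (integrable_indicator_iff hE).2 (integrableOn_const ?_)
    exact ((measure_mono subset_closure).trans_lt (hμ ⟨_, hE'⟩).lt_top).ne
  · refine tendsto_const_nhds.congr' ?_
    filter_upwards [Ici_mem_atTop (⟨closure E, hE'⟩ : Compacts X)] with C hC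
    rw [integral_restr_indicator μ (hμ C) c hE, Set.inter_eq_left.2]
    exact subset_closure.trans hC

theorem HasIntegral.smul_measure [SigmaCompactSpace X] (hμ : ∀ C : Compacts X, μ.variation C ≠ ∞)
    (c : 𝕜) (hf : μ.HasIntegral f I) : (c • μ).HasIntegral f (c * I) := by
  have hcμ : ∀ C : Compacts X, (c • μ).variation C ≠ ∞ := fun C =>
    ((variation_smul_le c μ C).trans_lt (ENNReal.mul_lt_top ENNReal.coe_lt_top (hμ C).lt_top)).ne
  have hint : ∀ g : X → 𝕜, Integrable g μ.variation → Integrable g (c • μ).variation := fun g hg =>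
    (Integrable.smul_measure_nnreal (f := g) hg (c := ‖c‖₊)).mono_measure (variation_smul_le c μ)
  refine ⟨hint f hf.1, (hf.2.const_mul c).congr fun C => ?_⟩
  refine eq_of_eq_indicator (ν := μ.variation) ‖c‖₊
    (A := fun f => c * ∫ᵛ x, f x ∂[ContinuousLinearMap.mul ℝ 𝕜; μ.restr C])
    (B := fun f => ∫ᵛ x, f x ∂[ContinuousLinearMap.mul ℝ 𝕜; (c • μ).restr C])
    (fun f g hf hg => ?_) (fun f g hf hg => ?_) (fun f g hf hg => ?_) (fun f g hf hg => ?_)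
    (fun a s hs _ => ?_) hf.1
  · rw [← mul_add]
    congr 1
    exact VectorMeasure.integral_add (integrable_restr hf C) (integrable_restr hg C)
  · exact VectorMeasure.integral_add (integrable_restr (hint f hf) C)
      (integrable_restr (hint g hg) C)
  · rw [← mul_sub, ← VectorMeasure.integral_fun_sub (integrable_restr hf C)
      (integrable_restr hg C), enorm_mul]
    gcongr
    · exact le_rfl
    · exact (enorm_integral_restr_le μ _ C).trans
        (lintegral_mono' Measure.restrict_le_self le_rfl)
  · rw [← VectorMeasure.integral_fun_sub (integrable_restr (hint f hf) C)
      (integrable_restr (hint g hg) C)]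
    refine (enorm_integral_restr_le _ _ C).trans ?_
    refine (lintegral_mono' (Measure.restrict_le_self.trans (variation_smul_le c μ))
      le_rfl).trans (le_of_eq ?_)
    rw [lintegral_smul_measure]
    rfl
  · rw [integral_restr_indicator μ (hμ C) a hs, integral_restr_indicator _ (hcμ C) a hs,
      smul_apply]
    ring

end RadonMeasure

/-! ### Fractional packings -/

/-- Let `r` be a reflexive symmetric relation on a finite set of items with sizes `ρ`, and suppose
that for each item the items at least as large that are related to it have total weight `≤ c`. Then
`∑ w f ≤ c M` as soon as `∑ f ≤ M` over all sets of pairwise unrelated items. The proof is the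
local ratio method: peel off `f i` on the neighbours of the smallest item `i` of positive value,
which every maximal set of unrelated items has to pay. -/
theorem sum_mul_le_of_independent_le {ι : Type*} (s : Finset ι) (r : ι → ι → Prop)
    (hrefl : ∀ i, r i i) (hsymm : ∀ i j, r i j → r j i) (ρ : ι → ℝ) (w : ι → ℝ)
    (hw : ∀ i ∈ s, 0 ≤ w i) {c : ℝ} (hc : 0 ≤ c)
    (hloc : ∀ i ∈ s, ∀ t ⊆ s, (∀ j ∈ t, r i j ∧ ρ i ≤ ρ j) → ∑ j ∈ t, w j ≤ c) (f : ι → ℝ) :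
    ∃ t ⊆ s, (t : Set ι).Pairwise (fun i j => ¬ r i j) ∧ (∀ i ∈ t, 0 < f i) ∧
      ∑ i ∈ s, w i * f i ≤ c * ∑ i ∈ t, f i := by
  classical
  induction hn : (s.filter (0 < f ·)).card using Nat.strong_induction_on generalizing f with
  | _ n ih =>
  rcases (s.filter (0 < f ·)).eq_empty_or_nonempty with he | hne
  · refine ⟨∅, by simp, by simp, by simp, ?_⟩
    rw [Finset.sum_empty, mul_zero]
    refine Finset.sum_nonpos fun i hi => mul_nonpos_of_nonneg_of_nonpos (hw i hi) ?_
    by_contra! h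
    exact Finset.notMem_empty i (he ▸ Finset.mem_filter.2 ⟨hi, h⟩)
  obtain ⟨i, hi, hmin⟩ := Finset.exists_min_image _ ρ hne
  obtain ⟨his, hfi⟩ := Finset.mem_filter.1 hi
  set g : ι → ℝ := fun j => if r i j ∧ 0 < f j then f i else 0 with hg
  have hg0 : ∀ j, 0 ≤ g j := fun j => by
    simp only [hg]; split_ifs <;> linarith
  have hlt : (s.filter (0 < (f - g) ·)).card < n := by
    rw [← hn]
    refine Finset.card_lt_card (Finset.ssubset_iff_of_subset ?_ |>.2 ⟨i, hi, ?_⟩)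
    · refine Finset.monotone_filter_right _ fun j _ hj => ?_
      have := hg0 j
      simp only [Pi.sub_apply] at hj
      linarith
    · simp [hg, hrefl, hfi]
  obtain ⟨t, hts, hind, hpos, hsum⟩ := ih _ hlt (f - g) rfl
  have hpos' : ∀ j ∈ t, 0 < f j := fun j hj => by
    have := hg0 j
    have := hpos j hj
    simp only [Pi.sub_apply] at this
    linarith
  have hwg : ∑ j ∈ s, w j * g j ≤ c * f i := by
    have h1 : ∑ j ∈ s, w j * g j = (∑ j ∈ s with r i j ∧ 0 < f j, w j) * f i := by
      rw [Finset.sum_mul, Finset.sum_filter]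
      exact Finset.sum_congr rfl fun j _ => by simp only [hg]; split_ifs <;> simp
    rw [h1]
    refine mul_le_mul_of_nonneg_right
      (hloc i his _ (Finset.filter_subset _ _) fun j hj => ?_) hfi.le
    obtain ⟨hjs, hj1, hj2⟩ := Finset.mem_filter.1 hj
    exact ⟨hj1, hmin j (Finset.mem_filter.2 ⟨hjs, hj2⟩)⟩
  have hsplit : ∑ j ∈ s, w j * f j = ∑ j ∈ s, w j * (f - g) j + ∑ j ∈ s, w j * g j := by
    rw [← Finset.sum_add_distrib]
    exact Finset.sum_congr rfl fun j _ => by simp only [Pi.sub_apply]; ring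
  have hfin : ∀ u ⊆ s, (u : Set ι).Pairwise (fun i j => ¬ r i j) → (∀ j ∈ u, 0 < f j) →
      (∑ j ∈ t, (f - g) j ≤ ∑ j ∈ u, (f - g) j) → (∃ j ∈ u, r i j) →
      ∃ t ⊆ s, (t : Set ι).Pairwise (fun i j => ¬ r i j) ∧ (∀ i ∈ t, 0 < f i) ∧
      ∑ i ∈ s, w i * f i ≤ c * ∑ i ∈ t, f i := by
    rintro u hus hu hup hle ⟨j, hju, hij⟩
    refine ⟨u, hus, hu, hup, ?_⟩
    have h1 : f i ≤ ∑ k ∈ u, g k := by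
      have : g j = f i := if_pos ⟨hij, hup j hju⟩
      rw [← this]
      exact Finset.single_le_sum (fun k _ => hg0 k) hju
    have h2 : ∑ k ∈ u, f k = ∑ k ∈ u, (f - g) k + ∑ k ∈ u, g k := by
      rw [← Finset.sum_add_distrib]
      exact Finset.sum_congr rfl fun j _ => by simp
    rw [hsplit, h2, mul_add]
    exact add_le_add (hsum.trans (mul_le_mul_of_nonneg_left hle hc))
      (hwg.trans (mul_le_mul_of_nonneg_left h1 hc))
  by_cases hex : ∃ j ∈ t, r i j
  · exact hfin t hts hind hpos' le_rfl hex
  · push Not at hex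
    have hit : i ∉ t := fun h => hex i h (hrefl i)
    refine hfin (insert i t) (Finset.insert_subset his hts) ?_ ?_ ?_ ⟨i, by simp, hrefl i⟩
    · rw [Finset.coe_insert]
      exact hind.insert fun j hj _ => ⟨hex j hj, fun h => hex j hj (hsymm _ _ h)⟩
    · simpa [hfi] using hpos'
    · rw [Finset.sum_insert hit]
      simp [hg, hrefl, hfi]

/-! ### Volumes of balls and Tonelli's theorem for cones -/

section Geometry

open scoped Pointwise

variable {n : ℕ}

theorem mem_nhds_zero_of_symm {S : Set (EuclideanSpace ℝ (Fin n))} (hconv : Convex ℝ S)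
    (hS : (interior S).Nonempty) (hsymm : ∀ x ∈ S, -x ∈ S) : S ∈ 𝓝 0 := by
  obtain ⟨x, hx⟩ := hS
  have h1 : -S = S := Set.ext fun y => ⟨fun hy => by simpa using hsymm _ hy, fun hy => hsymm _ hy⟩
  have h2 : -x ∈ interior S := by
    have h3 : -interior S = interior (-S) :=
      (Homeomorph.neg (EuclideanSpace ℝ (Fin n))).preimage_interior S
    rw [h1] at h3
    rw [← h3]
    simpa using hx
  have h4 := hconv.interior hx h2 (by norm_num : (0 : ℝ) ≤ 1 / 2)
    (by norm_num : (0 : ℝ) ≤ 1 / 2) (by norm_num)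
  exact mem_interior_iff_mem_nhds.1 (by simpa using h4)

variable {S : Set (EuclideanSpace ℝ (Fin n))}

theorem setOf_gauge_le (hconv : Convex ℝ S) (h0 : S ∈ 𝓝 0) (hcl : IsClosed S) {r : ℝ}
    (hr : 0 < r) : {x | gauge S x ≤ r} = r • S := by
  ext x
  rw [Set.mem_smul_set_iff_inv_smul_mem₀ hr.ne', ← hcl.closure_eq,
    ← gauge_le_one_iff_mem_closure hconv h0, gauge_smul_of_nonneg (inv_pos.2 hr).le, smul_eq_mul,
    inv_mul_le_one₀ hr, hcl.closure_eq]
  rfl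

theorem volume_gauge_sub_le (hconv : Convex ℝ S) (h0 : S ∈ 𝓝 0) (hcl : IsClosed S)
    (y : EuclideanSpace ℝ (Fin n)) {r : ℝ} (hr : 0 < r) :
    volume {x | gauge S (x - y) ≤ r} = ENNReal.ofReal (r ^ n) * volume S := by
  have h1 : {x | gauge S (x - y) ≤ r} = (fun x => x - y) ⁻¹' {x | gauge S x ≤ r} := rfl
  simp only [sub_eq_add_neg] at h1
  simp only [sub_eq_add_neg, h1]
  rw [measure_preimage_add_right, setOf_gauge_le hconv h0 hcl hr, Measure.addHaar_smul]
  simp [abs_of_pos (pow_pos hr n)]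

theorem volume_gauge_sub_eq (hconv : Convex ℝ S) (h0 : S ∈ 𝓝 0)
    (y : EuclideanSpace ℝ (Fin n)) {r : ℝ} (hr : 0 < r) :
    volume {x | gauge S (x - y) = r} = 0 := by
  have h1 : {x | gauge S (x - y) = r} = (fun x => x - y) ⁻¹' (r • frontier S) := by
    ext x
    rw [Set.mem_preimage, Set.mem_smul_set_iff_inv_smul_mem₀ hr.ne',
      ← gauge_eq_one_iff_mem_frontier hconv h0, gauge_smul_of_nonneg (inv_pos.2 hr).le,
      smul_eq_mul, inv_mul_eq_one₀ hr.ne']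
    exact eq_comm
  simp only [sub_eq_add_neg] at h1
  simp only [sub_eq_add_neg, h1]
  rw [measure_preimage_add_right, Measure.addHaar_smul, hconv.addHaar_frontier volume, mul_zero]

theorem isClosed_cone_relation (hcont : Continuous (gauge S)) :
    IsClosed {q : EuclideanSpace ℝ (Fin n) × HalfSpace n | gauge S (q.1 - q.2.1) ≤ q.2.2} :=
  isClosed_le (hcont.comp (by fun_prop)) (by fun_prop)

/-- Tonelli's theorem for the relation `p ∈ Γ_x ↔ x ∈ B(p)`. -/
theorem setLIntegral_measure_cone (hcont : Continuous (gauge S)) (ν : Measure (HalfSpace n))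
    [SFinite ν] (A : Set (EuclideanSpace ℝ (Fin n))) :
    ∫⁻ x in A, ν (cone S x) = ∫⁻ p, volume (kBall S p ∩ A) ∂ν := by
  have hm := (isClosed_cone_relation hcont).measurableSet
  have h1 := Measure.prod_apply (μ := volume.restrict A) (ν := ν) hm
  rw [Measure.prod_apply_symm hm] at h1
  have h2 : ∀ p : HalfSpace n, volume.restrict A (kBall S p) = volume (kBall S p ∩ A) :=
    fun p => Measure.restrict_apply (isClosed_le (hcont.comp (by fun_prop))
      continuous_const).measurableSet
  calc ∫⁻ x in A, ν (cone S x) = ∫⁻ p, volume.restrict A (kBall S p) ∂ν := h1.symm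
    _ = _ := lintegral_congr h2

/-- For almost every `x`, the boundary of the cone `Γ_x` is a null set. -/
theorem ae_measure_gauge_eq_zero (hconv : Convex ℝ S) (h0 : S ∈ 𝓝 0) (ν : Measure (HalfSpace n))
    [SFinite ν] :
    ∀ᵐ x : EuclideanSpace ℝ (Fin n), ν {p : HalfSpace n | gauge S (x - p.1) = p.2} = 0 := by
  have hcont : Continuous (gauge S) := continuous_gauge hconv h0
  have hm : MeasurableSet {q : EuclideanSpace ℝ (Fin n) × HalfSpace n |
      gauge S (q.1 - q.2.1) = q.2.2} :=
    (isClosed_eq (hcont.comp (by fun_prop)) (by fun_prop)).measurableSet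
  refine (Measure.measure_prod_null (μ := volume) (ν := ν) hm).1 ?_
  rw [Measure.prod_apply_symm hm]
  refine (lintegral_congr fun p => ?_).trans lintegral_zero
  exact volume_gauge_sub_eq hconv h0 p.1 p.2.2

/-- If the cones `Γ_x` have `ν`-measure at most `M`, then so do, up to the factor `8ⁿ`, the sets of
all balls that are not much smaller than a given ball and come close to it: each of them covers a
fixed proportion of a multiple of the given ball. Balls that touch the given one satisfy
`‖q.1 - y‖ ≤ q.2 + T`; the remaining room makes the estimate stable under small perturbations. -/
theorem measure_large_near_balls_le (hconv : Convex ℝ S) (h0 : S ∈ 𝓝 0) (hc : IsCompact S)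
    (hsymm : ∀ x ∈ S, -x ∈ S) (ν : Measure (HalfSpace n)) [SFinite ν] {M : ℝ≥0∞}
    (hM : ∀ᵐ x, ν (cone S x) ≤ M) (y : EuclideanSpace ℝ (Fin n)) {T : ℝ} (hT : 0 < T) :
    ν {q : HalfSpace n | 3 * T / 4 ≤ q.2 ∧ gauge S (q.1 - y) ≤ q.2 + 2 * T} ≤ 8 ^ n * M := by
  have hcont : Continuous (gauge S) := continuous_gauge hconv h0
  have habs : Absorbent ℝ S := absorbent_nhds_zero h0
  have hV0 : volume S ≠ 0 := (Measure.measure_pos_of_mem_nhds volume h0).ne'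
  have hVt : volume S ≠ ∞ := hc.measure_lt_top.ne
  set Q : Set (HalfSpace n) := {q | 3 * T / 4 ≤ q.2 ∧ gauge S (q.1 - y) ≤ q.2 + 2 * T} with hQ
  set A : Set (EuclideanSpace ℝ (Fin n)) := {x | gauge S (x - y) ≤ 4 * T} with hA
  set v : ℝ≥0∞ := ENNReal.ofReal ((T / 2) ^ n) * volume S with hv
  have hsub : ∀ q ∈ Q, v ≤ volume (kBall S q ∩ A) := by
    rintro q ⟨hq1, hq2⟩
    -- The ball of radius `T / 2` around `z` lies in the ball of `q` and in `A`; the center `z` is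
    -- `q.1`, moved towards `y` if it is too far away.
    obtain ⟨z, hz1, hz2⟩ : ∃ z, gauge S (z - q.1) ≤ q.2 - T / 2 ∧ gauge S (z - y) ≤ 3 * T := by
      by_cases hG : gauge S (q.1 - y) ≤ 3 * T
      · exact ⟨q.1, by simp; linarith, hG⟩
      · push Not at hG
        set G := gauge S (q.1 - y) with hGdef
        have hGpos : 0 < G := by linarith
        have hs : 0 ≤ 3 * T / G := by positivity
        have hs1 : 3 * T / G ≤ 1 := (div_le_one hGpos).2 hG.le
        refine ⟨y + (3 * T / G) • (q.1 - y), ?_, ?_⟩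
        · have h1 : y + (3 * T / G) • (q.1 - y) - q.1 = -((1 - 3 * T / G) • (q.1 - y)) := by
            module
          rw [h1, gauge_neg hsymm, gauge_smul_of_nonneg (by linarith), ← hGdef, smul_eq_mul,
            sub_mul, div_mul_cancel₀ _ hGpos.ne']
          linarith
        · rw [add_sub_cancel_left, gauge_smul_of_nonneg hs, ← hGdef, smul_eq_mul,
            div_mul_cancel₀ _ hGpos.ne']
    rw [hv, ← volume_gauge_sub_le hconv h0 hc.isClosed z (half_pos hT)]
    refine measure_mono fun x hx => ⟨?_, ?_⟩
    · have h1 := gauge_add_le hconv habs (x - z) (z - q.1)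
      rw [sub_add_sub_cancel] at h1
      have : gauge S (x - z) ≤ T / 2 := hx
      change gauge S (x - q.1) ≤ q.2
      linarith
    · have h1 := gauge_add_le hconv habs (x - z) (z - y)
      rw [sub_add_sub_cancel] at h1
      have : gauge S (x - z) ≤ T / 2 := hx
      change gauge S (x - y) ≤ 4 * T
      linarith
  have hQ1 : IsClosed {q : HalfSpace n | 3 * T / 4 ≤ (q.2 : ℝ)} :=
    isClosed_le (by fun_prop) (by fun_prop)
  have hQ2 : IsClosed {q : HalfSpace n | gauge S (q.1 - y) ≤ (q.2 : ℝ) + 2 * T} :=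
    isClosed_le (hcont.comp (by fun_prop)) (by fun_prop)
  have hQm : MeasurableSet Q := (hQ1.inter hQ2).measurableSet
  have hv0 : v ≠ 0 := mul_ne_zero (by simp; positivity) hV0
  have hvt : v ≠ ∞ := ENNReal.mul_ne_top ENNReal.ofReal_ne_top hVt
  have h8 : volume A = 8 ^ n * v := by
    have h1 : (4 * T) ^ n = 8 ^ n * (T / 2) ^ n := by rw [← mul_pow]; ring_nf
    rw [hA, volume_gauge_sub_le hconv h0 hc.isClosed y (by positivity), hv, h1,
      ENNReal.ofReal_mul (by positivity), ENNReal.ofReal_pow (by norm_num), mul_assoc]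
    norm_num
  have hmain : v * ν Q ≤ v * (8 ^ n * M) := by
    calc v * ν Q = ∫⁻ _ in Q, v ∂ν := by rw [setLIntegral_const]
      _ ≤ ∫⁻ q in Q, volume (kBall S q ∩ A) ∂ν := setLIntegral_mono' hQm hsub
      _ ≤ ∫⁻ q, volume (kBall S q ∩ A) ∂ν := setLIntegral_le_lintegral _ _
      _ = ∫⁻ x in A, ν (cone S x) := (setLIntegral_measure_cone hcont ν A).symm
      _ ≤ ∫⁻ _ in A, M := lintegral_mono_ae (ae_restrict_of_ae hM)
      _ = v * (8 ^ n * M) := by rw [setLIntegral_const, h8]; ring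
  exact (ENNReal.mul_le_mul_iff_right hv0 hvt).1 hmain

end Geometry

/-! ### The duality inequality -/

section DualityInequality

variable {n : ℕ} {S : Set (EuclideanSpace ℝ (Fin n))}

/-- On a compact set `C`, a simple function with finitely many values in `C` moves the points of `C`
by less than `δ`. -/
theorem exists_simpleFunc_dist_lt {X : Type*} [PseudoMetricSpace X] [MeasurableSpace X]
    [OpensMeasurableSpace X] {C : Set X} (hC : IsCompact C) (hne : C.Nonempty) {δ : ℝ}
    (hδ : 0 < δ) : ∃ g : SimpleFunc X X, (∀ p, g p ∈ C) ∧ ∀ p ∈ C, dist (g p) p < δ := by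
  obtain ⟨t, htC, htf, hcov⟩ := hC.finite_cover_balls hδ
  have htne : t.Nonempty := by
    obtain ⟨p, hp⟩ := hne
    obtain ⟨z, hz, -⟩ := Set.mem_iUnion₂.1 (hcov hp)
    exact ⟨z, hz⟩
  obtain ⟨e, he⟩ := htf.countable.exists_eq_range htne
  have hidx : ∀ z, ∃ k, z ∈ t → e k = z := fun z => by
    by_cases hz : z ∈ t
    · rw [he] at hz
      obtain ⟨k, hk⟩ := hz
      exact ⟨k, fun _ => hk⟩
    · exact ⟨0, fun h => absurd h hz⟩
  choose idx hidx using hidx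
  refine ⟨SimpleFunc.nearestPt e (htf.toFinset.sup idx), fun p => htC (he.ge ⟨_, rfl⟩),
    fun p hp => ?_⟩
  · obtain ⟨z, hz, hpz⟩ := Set.mem_iUnion₂.1 (hcov hp)
    have h1 := SimpleFunc.edist_nearestPt_le e p
      (Finset.le_sup (f := idx) (htf.mem_toFinset.2 hz))
    rw [hidx z hz] at h1
    rw [← edist_lt_ofReal]
    refine h1.trans_lt ?_
    rw [edist_lt_ofReal, dist_comm]
    exact hpz

/-- The sum of `‖f‖` against the point masses of a discretization `g` of `ν`: the fractional packing
with weights `ν(g⁻¹{z}) / (8ⁿ M)` is dominated by packings. The points may move by a quarter of the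
smallest radius. -/
theorem sum_measure_preimage_mul_le {𝕜 : Type*} [RCLike 𝕜] (hconv : Convex ℝ S) (h0 : S ∈ 𝓝 0)
    (hc : IsCompact S) (hsymm : ∀ x ∈ S, -x ∈ S) (ν : Measure (HalfSpace n)) [IsFiniteMeasure ν]
    {M : ℝ≥0∞} (hMt : M ≠ ∞) (hM : ∀ᵐ x, ν (cone S x) ≤ M) (f : HalfSpace n → 𝕜)
    (g : SimpleFunc (HalfSpace n) (HalfSpace n))
    (hg : ∀ᵐ p ∂ν, ∀ q, gauge S (p.1 - (g p).1) ≤ (g q).2 / 4 ∧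
      |(p.2 : ℝ) - (g p).2| ≤ (g q).2 / 4) :
    ∑ z ∈ g.range, ‖f z‖ₑ * ν (g ⁻¹' {z}) ≤ 8 ^ n * (M * s1ENorm S f) := by
  classical
  have habs : Absorbent ℝ S := absorbent_nhds_zero h0
  have hct : 8 ^ n * M ≠ ∞ := ENNReal.mul_ne_top (by finiteness) hMt
  have hloc : ∀ i ∈ g.range, ∀ t ⊆ g.range,
      (∀ j ∈ t, ¬ Disjoint (kBall S i) (kBall S j) ∧ (i.2 : ℝ) ≤ j.2) →
        ∑ j ∈ t, ν.real (g ⁻¹' {j}) ≤ (8 ^ n * M).toReal := by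
    intro i hi t hts ht
    obtain ⟨q, rfl⟩ := SimpleFunc.mem_range.1 hi
    set i := g q
    have h1 : ∑ z ∈ t, ν.real (g ⁻¹' {z}) = ν.real (g ⁻¹' t) := by
      rw [← Set.biUnion_preimage_singleton, ← measureReal_biUnion_finset]
      · rfl
      · exact fun a _ b _ hab => Disjoint.preimage _ (by simpa using hab)
      · exact fun z _ => g.measurableSet_preimage _
    rw [h1, measureReal_def]
    refine ENNReal.toReal_mono hct ?_
    refine le_trans (measure_mono_ae ?_)
      (measure_large_near_balls_le hconv h0 hc hsymm ν hM i.1 i.2.2)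
    filter_upwards [hg] with p hp hpt
    obtain ⟨hr, hle⟩ := ht _ hpt
    obtain ⟨x, hx1, hx2⟩ := Set.not_disjoint_iff.1 hr
    obtain ⟨hp1, hp2⟩ := hp q
    have hx1' : gauge S (x - i.1) ≤ i.2 := hx1
    have hx2' : gauge S (x - (g p).1) ≤ (g p).2 := hx2
    have h4 := gauge_add_le hconv habs (p.1 - (g p).1) ((g p).1 - x)
    have h5 := gauge_add_le hconv habs (p.1 - x) (x - i.1)
    rw [sub_add_sub_cancel] at h4 h5
    rw [← neg_sub x (g p).1, gauge_neg hsymm] at h4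
    have h6 := abs_le.1 hp2
    have hi0 : (0 : ℝ) < i.2 := i.2.2
    constructor <;> linarith [h6.1, h6.2]
  obtain ⟨t, hts, hind, -, hsum⟩ := sum_mul_le_of_independent_le g.range
    (fun p q => ¬ Disjoint (kBall S p) (kBall S q))
    (fun p => Set.not_disjoint_iff.2 ⟨p.1, by simpa [kBall] using p.2.2.le,
      by simpa [kBall] using p.2.2.le⟩)
    (fun p q h => fun h' => h h'.symm) (fun p => (p.2 : ℝ)) (fun z => ν.real (g ⁻¹' {z}))
    (fun z _ => measureReal_nonneg) (c := (8 ^ n * M).toReal) ENNReal.toReal_nonneg hloc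
    (fun z => ‖f z‖)
  have h1 : ∑ z ∈ t, ‖f z‖ₑ ≤ s1ENorm S f := by
    refine le_iSup₂_of_le t (fun p hp q hq hpq => ?_) le_rfl
    exact not_not.1 (hind hp hq hpq)
  have h2 : ∑ z ∈ g.range, ‖f z‖ₑ * ν (g ⁻¹' {z})
      = ENNReal.ofReal (∑ z ∈ g.range, ν.real (g ⁻¹' {z}) * ‖f z‖) := by
    rw [ENNReal.ofReal_sum_of_nonneg (fun z _ => by positivity)]
    refine Finset.sum_congr rfl fun z _ => ?_
    rw [ENNReal.ofReal_mul measureReal_nonneg, ofReal_measureReal, ofReal_norm, mul_comm]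
  have h3 : ENNReal.ofReal (∑ z ∈ t, ‖f z‖) = ∑ z ∈ t, ‖f z‖ₑ := by
    rw [ENNReal.ofReal_sum_of_nonneg (fun z _ => norm_nonneg _)]
    simp
  rw [h2, ← mul_assoc]
  refine (ENNReal.ofReal_le_ofReal hsum).trans ?_
  rw [ENNReal.ofReal_mul ENNReal.toReal_nonneg, ENNReal.ofReal_toReal hct, h3]
  gcongr

/-- The inequality behind the boundedness of `l_μ`: packings dominate fractional packings. -/
theorem setLIntegral_enorm_le {𝕜 : Type*} [RCLike 𝕜] (hconv : Convex ℝ S) (h0 : S ∈ 𝓝 0)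
    (hc : IsCompact S) (hsymm : ∀ x ∈ S, -x ∈ S) (ν : Measure (HalfSpace n))
    {M : ℝ≥0∞} (hMt : M ≠ ∞) (hM : ∀ᵐ x, ν (cone S x) ≤ M) {f : HalfSpace n → 𝕜}
    (hfc : Continuous f) {C : Set (HalfSpace n)} (hC : IsCompact C)
    (hνC : ν C ≠ ∞) :
    ∫⁻ p in C, ‖f p‖ₑ ∂ν ≤ 8 ^ n * (M * s1ENorm S f) := by
  rcases C.eq_empty_or_nonempty with rfl | hne
  · simp
  have hcont : Continuous (gauge S) := continuous_gauge hconv h0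
  have : IsFiniteMeasure (ν.restrict C) := ⟨by simpa using hνC.lt_top⟩
  obtain ⟨p₀, hp₀, hmin⟩ := hC.exists_isMinOn hne (f := fun p : HalfSpace n => (p.2 : ℝ))
    (by fun_prop)
  set a : ℝ := (p₀.2 : ℝ) with ha
  have ha0 : 0 < a := p₀.2.2
  obtain ⟨δ₁, hδ₁, hgauge⟩ : ∃ δ > 0, ∀ v : EuclideanSpace ℝ (Fin n), ‖v‖ < δ →
      gauge S v < a / 4 := by
    have h1 : ∀ᶠ v in 𝓝 (0 : EuclideanSpace ℝ (Fin n)), gauge S v < a / 4 :=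
      hcont.continuousAt.eventually (gt_mem_nhds (by simpa using ha0))
    obtain ⟨δ, hδ, h2⟩ := Metric.eventually_nhds_iff.1 h1
    exact ⟨δ, hδ, fun v hv => h2 (by simpa using hv)⟩
  have key : ∀ ε > (0 : ℝ),
      ∫⁻ p in C, ‖f p‖ₑ ∂ν ≤ 8 ^ n * (M * s1ENorm S f) + ENNReal.ofReal ε * ν C := by
    intro ε hε
    obtain ⟨δ₂, hδ₂, hunif⟩ := Metric.mem_uniformity_dist.1
      (hC.uniformContinuousAt_of_continuousAt f (fun p _ => hfc.continuousAt)
        (Metric.dist_mem_uniformity hε))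
    obtain ⟨g, hgC, hg⟩ := exists_simpleFunc_dist_lt hC hne
      (lt_min (lt_min hδ₁ hδ₂) (by positivity : 0 < a / 4))
    have hpt : ∀ p ∈ C, ‖f p‖ₑ ≤ ‖f (g p)‖ₑ + ENNReal.ofReal ε := by
      intro p hp
      have h1 : dist (f p) (f (g p)) < ε := hunif (by
        rw [dist_comm]
        exact (hg p hp).trans_le ((min_le_left _ _).trans (min_le_right _ _))) hp
      have h2 : ‖f p - f (g p)‖ₑ ≤ ENNReal.ofReal ε := by
        rw [← ofReal_norm, ← dist_eq_norm]
        exact ENNReal.ofReal_le_ofReal h1.le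
      calc ‖f p‖ₑ = ‖f (g p) + (f p - f (g p))‖ₑ := by rw [add_sub_cancel]
        _ ≤ _ := (enorm_add_le _ _).trans (by gcongr)
    have hga : ∀ᵐ p ∂ν.restrict C, ∀ q, gauge S (p.1 - (g p).1) ≤ (g q).2 / 4 ∧
        |(p.2 : ℝ) - (g p).2| ≤ (g q).2 / 4 := by
      filter_upwards [ae_restrict_mem hC.measurableSet] with p hp q
      have hq : a ≤ (g q).2 := hmin (hgC q)
      have hd := hg p hp
      have h1 : ‖p.1 - (g p).1‖ ≤ dist (g p) p := by
        rw [← dist_eq_norm, dist_comm]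
        exact le_max_left _ _
      have h2 : |(p.2 : ℝ) - (g p).2| ≤ dist (g p) p := by
        rw [← Real.dist_eq, dist_comm]
        exact le_max_right (dist (g p).1 p.1) _
      have h3 := hgauge _ (h1.trans_lt (hd.trans_le ((min_le_left _ _).trans (min_le_left _ _))))
      have h4 := hd.trans_le (min_le_right _ _)
      constructor <;> linarith
    have hMC : ∀ᵐ x, ν.restrict C (cone S x) ≤ M := by
      filter_upwards [hM] with x hx
      exact (Measure.restrict_le_self _).trans hx
    calc ∫⁻ p in C, ‖f p‖ₑ ∂ν ≤ ∫⁻ p in C, (‖f (g p)‖ₑ + ENNReal.ofReal ε) ∂ν :=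
          setLIntegral_mono' hC.measurableSet hpt
      _ = ∫⁻ p in C, (g.map fun z => ‖f z‖ₑ) p ∂ν + ENNReal.ofReal ε * ν C := by
          rw [lintegral_add_right _ measurable_const, setLIntegral_const]
          rfl
      _ ≤ _ := by
          rw [SimpleFunc.lintegral_eq_lintegral, SimpleFunc.map_lintegral]
          gcongr
          exact sum_measure_preimage_mul_le hconv h0 hc hsymm (ν.restrict C) hMt hMC f g hga
  have hlim : Tendsto (fun ε : ℝ => 8 ^ n * (M * s1ENorm S f) + ENNReal.ofReal ε * ν C) (𝓝[>] 0)
      (𝓝 (8 ^ n * (M * s1ENorm S f) + 0 * ν C)) := by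
    refine tendsto_const_nhds.add (ENNReal.Tendsto.mul_const ?_ (Or.inr hνC))
    have := (ENNReal.continuous_ofReal.tendsto 0).mono_left (nhdsWithin_le_nhds (s := Set.Ioi 0))
    simpa using this
  rw [zero_mul, add_zero] at hlim
  exact ge_of_tendsto hlim (eventually_mem_nhdsWithin.mono key)

end DualityInequality

/-! ### Representation of functionals on `C_c` by Radon measures -/

section Riesz

open scoped NNReal CompactlySupported

variable {X : Type*} [TopologicalSpace X] {𝕜 : Type*} [RCLike 𝕜]

/-- A compactly supported function dominated by `f₁ + f₂` is the sum of functions dominated by `f₁`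
and by `f₂`. -/
theorem exists_dominated_decomposition (f₁ f₂ : C_c(X, ℝ≥0)) (g : C_c(X, 𝕜))
    (hg : ∀ x, ‖g x‖₊ ≤ (f₁ + f₂) x) :
    ∃ g₁ g₂ : C_c(X, 𝕜), (∀ x, ‖g₁ x‖₊ ≤ f₁ x) ∧ (∀ x, ‖g₂ x‖₊ ≤ f₂ x) ∧ g₁ + g₂ = g := by
  have hg' : ∀ x, ‖g x‖ ≤ f₁ x + f₂ x := fun x => by exact_mod_cast hg x
  have key : ∀ f : C_c(X, ℝ≥0), (∀ x, f x ≤ f₁ x + f₂ x) → ∃ h : C_c(X, 𝕜),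
      ∀ x, h x = (((f x : ℝ) / (f₁ x + f₂ x) : ℝ) : 𝕜) * g x := by
    intro f hf
    have hle : ∀ x, ‖(((f x : ℝ) / (f₁ x + f₂ x) : ℝ) : 𝕜) * g x‖ ≤ ‖g x‖ := fun x => by
      rw [norm_mul, RCLike.norm_ofReal, abs_of_nonneg (by positivity)]
      refine mul_le_of_le_one_left (norm_nonneg _) (div_le_one_of_le₀ ?_ (by positivity))
      exact_mod_cast hf x
    have hc : Continuous fun x => (((f x : ℝ) / (f₁ x + f₂ x) : ℝ) : 𝕜) * g x := by
      refine continuous_iff_continuousAt.2 fun x => ?_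
      by_cases hx : ((f₁ x : ℝ) + f₂ x) = 0
      · have hgx : g x = 0 := by
          rw [← norm_le_zero_iff]
          exact (hg' x).trans_eq hx
        have h0 : Tendsto (fun y => ‖g y‖) (𝓝 x) (𝓝 0) := by
          have := (map_continuous g).norm.tendsto x
          rwa [hgx, norm_zero] at this
        rw [ContinuousAt, hgx, mul_zero]
        exact squeeze_zero_norm hle h0
      · refine ContinuousAt.mul ?_ (map_continuous g).continuousAt
        refine RCLike.continuous_ofReal.continuousAt.comp ?_
        exact ContinuousAt.div (by fun_prop) (by fun_prop) hx
    exact ⟨⟨⟨_, hc⟩, g.hasCompactSupport.mul_left⟩, fun x => rfl⟩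
  obtain ⟨g₁, h₁⟩ := key f₁ fun x => le_self_add
  obtain ⟨g₂, h₂⟩ := key f₂ fun x => le_add_self
  have hbd : ∀ (f : C_c(X, ℝ≥0)) (h : C_c(X, 𝕜)),
      (∀ x, h x = (((f x : ℝ) / (f₁ x + f₂ x) : ℝ) : 𝕜) * g x) → ∀ x, ‖h x‖₊ ≤ f x := by
    intro f h hh x
    rw [← NNReal.coe_le_coe, coe_nnnorm, hh, norm_mul, RCLike.norm_ofReal,
      abs_of_nonneg (by positivity)]
    rcases (by positivity : (0 : ℝ) ≤ f₁ x + f₂ x).eq_or_lt with h0 | h0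
    · rw [← h0]
      simp
    · calc _ ≤ (f x : ℝ) / (f₁ x + f₂ x) * (f₁ x + f₂ x) := by gcongr; exact hg' x
        _ = f x := div_mul_cancel₀ _ h0.ne'
  refine ⟨g₁, g₂, hbd f₁ g₁ h₁, hbd f₂ g₂ h₂, ?_⟩
  ext x
  rw [CompactlySupportedContinuousMap.add_apply, h₁, h₂, ← add_mul, ← RCLike.ofReal_add, ← add_div]
  by_cases hx : ((f₁ x : ℝ) + f₂ x) = 0
  · have hgx : g x = 0 := by
      rw [← norm_le_zero_iff]
      exact (hg' x).trans_eq hx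
    rw [hgx, mul_zero]
  · rw [div_self hx]
    simp

/-- The total variation `f ↦ sup {|l g| : |g| ≤ f}` of a functional `l` on `C_c(X, 𝕜)`, with
values in `ℝ≥0`. The supremum has its junk value `0` if it is infinite. -/
noncomputable def absFun (l : C_c(X, 𝕜) →ₗ[𝕜] 𝕜) (f : C_c(X, ℝ≥0)) : ℝ≥0 :=
  ⨆ g : {g : C_c(X, 𝕜) // ∀ x, ‖g x‖₊ ≤ f x}, ‖l g‖₊

/-- A functional on `C_c(X, 𝕜)` is order bounded if it is bounded on the set of all functions
dominated by a fixed one. -/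
def OrderBounded (l : C_c(X, 𝕜) →ₗ[𝕜] 𝕜) : Prop :=
  ∀ f : C_c(X, ℝ≥0), ∃ B : ℝ≥0, ∀ g : C_c(X, 𝕜), (∀ x, ‖g x‖₊ ≤ f x) → ‖l g‖₊ ≤ B

theorem absFun_le {l : C_c(X, 𝕜) →ₗ[𝕜] 𝕜} {f : C_c(X, ℝ≥0)} {B : ℝ≥0}
    (h : ∀ g : C_c(X, 𝕜), (∀ x, ‖g x‖₊ ≤ f x) → ‖l g‖₊ ≤ B) : absFun l f ≤ B := by
  have : Nonempty {g : C_c(X, 𝕜) // ∀ x, ‖g x‖₊ ≤ f x} := ⟨⟨0, fun x => by simp⟩⟩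
  exact ciSup_le fun g => h g.1 g.2

theorem le_absFun {l : C_c(X, 𝕜) →ₗ[𝕜] 𝕜} (hl : OrderBounded l) {f : C_c(X, ℝ≥0)} {g : C_c(X, 𝕜)}
    (hg : ∀ x, ‖g x‖₊ ≤ f x) : ‖l g‖₊ ≤ absFun l f := by
  obtain ⟨B, hB⟩ := hl f
  refine le_ciSup (f := fun g : {g : C_c(X, 𝕜) // ∀ x, ‖g x‖₊ ≤ f x} => ‖l g‖₊) ⟨B, ?_⟩ ⟨g, hg⟩
  rintro _ ⟨g, rfl⟩
  exact hB g.1 g.2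

theorem absFun_add {l : C_c(X, 𝕜) →ₗ[𝕜] 𝕜} (hl : OrderBounded l) (f₁ f₂ : C_c(X, ℝ≥0)) :
    absFun l (f₁ + f₂) = absFun l f₁ + absFun l f₂ := by
  refine le_antisymm (absFun_le fun g hg => ?_) ?_
  · obtain ⟨g₁, g₂, h₁, h₂, rfl⟩ := exists_dominated_decomposition f₁ f₂ g hg
    rw [map_add]
    exact (nnnorm_add_le _ _).trans (add_le_add (le_absFun hl h₁) (le_absFun hl h₂))
  · have key : ∀ g₁ g₂ : C_c(X, 𝕜), (∀ x, ‖g₁ x‖₊ ≤ f₁ x) → (∀ x, ‖g₂ x‖₊ ≤ f₂ x) →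
        ‖l g₁‖₊ + ‖l g₂‖₊ ≤ absFun l (f₁ + f₂) := by
      intro g₁ g₂ h₁ h₂
      -- Unimodular factors make the values of `l` at both functions nonnegative.
      obtain ⟨u, hu, hu'⟩ := RCLike.exists_norm_eq_mul_self (l g₁)
      obtain ⟨v, hv, hv'⟩ := RCLike.exists_norm_eq_mul_self (l g₂)
      have hu1 : ‖u‖₊ = 1 := NNReal.coe_injective hu
      have hv1 : ‖v‖₊ = 1 := NNReal.coe_injective hv
      have h3 : ‖l (u • g₁ + v • g₂)‖₊ = ‖l g₁‖₊ + ‖l g₂‖₊ := by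
        rw [map_add, map_smul, map_smul, smul_eq_mul, smul_eq_mul, ← hu', ← hv',
          ← RCLike.ofReal_add]
        refine NNReal.coe_injective ?_
        rw [coe_nnnorm, RCLike.norm_ofReal, abs_of_nonneg (by positivity)]
        rfl
      rw [← h3]
      refine le_absFun hl fun x => ?_
      rw [CompactlySupportedContinuousMap.add_apply, CompactlySupportedContinuousMap.add_apply]
      refine (nnnorm_add_le _ _).trans (add_le_add ?_ ?_)
      · rw [CompactlySupportedContinuousMap.smul_apply, nnnorm_smul, hu1, one_mul]
        exact h₁ x
      · rw [CompactlySupportedContinuousMap.smul_apply, nnnorm_smul, hv1, one_mul]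
        exact h₂ x
    have h1 : ∀ g₁ : C_c(X, 𝕜), (∀ x, ‖g₁ x‖₊ ≤ f₁ x) →
        absFun l f₂ + ‖l g₁‖₊ ≤ absFun l (f₁ + f₂) := by
      intro g₁ hg₁
      rw [← le_tsub_iff_right (le_self_add.trans (key g₁ 0 hg₁ (fun x => by simp)))]
      refine absFun_le fun g₂ hg₂ => ?_
      refine le_tsub_of_add_le_left ?_
      exact key g₁ g₂ hg₁ hg₂
    have h2 : absFun l f₂ ≤ absFun l (f₁ + f₂) := by
      simpa using h1 0 (fun x => by simp)
    rw [← le_tsub_iff_right h2]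
    exact absFun_le fun g₁ hg₁ => le_tsub_of_add_le_left (h1 g₁ hg₁)

theorem absFun_smul {l : C_c(X, 𝕜) →ₗ[𝕜] 𝕜} (hl : OrderBounded l) (c : ℝ≥0) (f : C_c(X, ℝ≥0)) :
    absFun l (c • f) = c * absFun l f := by
  have key : ∀ (c : ℝ≥0) (f : C_c(X, ℝ≥0)), c ≠ 0 → absFun l (c • f) ≤ c * absFun l f := by
    intro c f hc
    refine absFun_le fun g hg => ?_
    have hn : ‖((c⁻¹ : ℝ) : 𝕜)‖₊ = c⁻¹ := by
      refine NNReal.coe_injective ?_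
      rw [coe_nnnorm, RCLike.norm_ofReal, abs_of_nonneg (by positivity)]
      rfl
    have h1 : ‖l (((c⁻¹ : ℝ) : 𝕜) • g)‖₊ ≤ absFun l f := by
      refine le_absFun hl fun x => ?_
      rw [CompactlySupportedContinuousMap.smul_apply, nnnorm_smul, hn,
        inv_mul_le_iff₀ (pos_iff_ne_zero.2 hc)]
      exact hg x
    rwa [map_smul, nnnorm_smul, hn, inv_mul_le_iff₀ (pos_iff_ne_zero.2 hc)] at h1
  rcases eq_or_ne c 0 with rfl | hc
  · rw [zero_smul, zero_mul]
    refine le_antisymm (absFun_le fun g hg => ?_) zero_le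
    have : g = 0 := CompactlySupportedContinuousMap.ext fun x => by simpa using hg x
    simp [this]
  · refine le_antisymm (key c f hc) ?_
    have h1 := key c⁻¹ (c • f) (inv_ne_zero hc)
    rwa [smul_smul, inv_mul_cancel₀ hc, one_smul, le_inv_mul_iff₀ (pos_iff_ne_zero.2 hc)] at h1

/-- The total variation of an order bounded functional, as a positive linear functional. -/
noncomputable def absFunctional (l : C_c(X, 𝕜) →ₗ[𝕜] 𝕜) (hl : OrderBounded l) :
    C_c(X, ℝ≥0) →ₗ[ℝ≥0] ℝ≥0 where
  toFun := absFun l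
  map_add' := absFun_add hl
  map_smul' := absFun_smul hl

variable [T2Space X] [MeasurableSpace X] [BorelSpace X]

theorem enorm_le_lintegral_rieszMeasure [LocallyCompactSpace X] {l : C_c(X, 𝕜) →ₗ[𝕜] 𝕜}
    (hl : OrderBounded l) (g : C_c(X, 𝕜)) :
    ‖l g‖ₑ ≤ ∫⁻ x, ‖g x‖ₑ ∂NNRealRMK.rieszMeasure (absFunctional l hl) := by
  set f : C_c(X, ℝ≥0) := g.compLeft ⟨fun z => ‖z‖₊, continuous_nnnorm⟩ with hf
  have hfx : ∀ x, f x = ‖g x‖₊ := fun x =>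
    CompactlySupportedContinuousMap.compLeft_apply (by simp) g x
  have h1 := NNRealRMK.lintegral_rieszMeasure (absFunctional l hl) f
  simp only [hfx] at h1
  change _ ≤ ∫⁻ x, (‖g x‖₊ : ℝ≥0∞) ∂_
  rw [h1]
  exact ENNReal.coe_le_coe.2 (le_absFun hl fun x => (hfx x).ge)

/-- A functional on `C_c` that is bounded for the `L¹(ν)`-norm extends to all integrable functions.
The extension is a function of the functions themselves, not of their classes. -/
theorem exists_extension_integrable [LocallyCompactSpace X] [NormalSpace X] {ν : Measure X}
    [ν.Regular] (l : C_c(X, 𝕜) →ₗ[𝕜] 𝕜)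
    (hl : ∀ g, ‖l g‖ₑ ≤ ∫⁻ x, ‖g x‖ₑ ∂ν) :
    ∃ L : (X → 𝕜) → 𝕜, (∀ f g, Integrable f ν → Integrable g ν → L (f + g) = L f + L g) ∧
      (∀ (c : 𝕜) f, Integrable f ν → L (c • f) = c * L f) ∧
      (∀ f, Integrable f ν → ‖L f‖ₑ ≤ ∫⁻ x, ‖f x‖ₑ ∂ν) ∧ ∀ g : C_c(X, 𝕜), L g = l g := by
  have hint : ∀ g : C_c(X, 𝕜), Integrable g ν :=
    fun g => (map_continuous g).integrable_of_hasCompactSupport g.hasCompactSupport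
  let e : C_c(X, 𝕜) →ₗ[𝕜] Lp 𝕜 1 ν :=
    { toFun := fun g => (hint g).toL1 g
      map_add' := fun f g => Integrable.toL1_add _ _ (hint f) (hint g)
      map_smul' := fun c g => Integrable.toL1_smul _ (hint g) c }
  have hdense : DenseRange e := by
    intro f
    refine EMetric.mem_closure_iff.2 fun ε' hε' => ?_
    obtain ⟨ε, hε, hεε⟩ : ∃ ε, 0 < ε ∧ ε < ε' := exists_between hε'
    obtain ⟨g, hgc, hg, hgcont, hgi⟩ :=
      (L1.integrable_coeFn f).exists_hasCompactSupport_lintegral_sub_le hε.ne'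
    refine ⟨e ⟨⟨g, hgcont⟩, hgc⟩, ⟨_, rfl⟩, ?_⟩
    rw [← Integrable.toL1_coeFn f (L1.integrable_coeFn f)]
    change edist _ (hgi.toL1 g) < ε'
    rw [Integrable.edist_toL1_toL1]
    simp only [edist_eq_enorm_sub]
    exact hg.trans_lt hεε
  have hnorm : ∀ g, ‖l g‖ ≤ 1 * ‖e g‖ := by
    intro g
    rw [one_mul, ← ENNReal.ofReal_le_ofReal_iff (norm_nonneg _), ofReal_norm, ofReal_norm]
    refine (hl g).trans_eq ?_
    exact (Integrable.enorm_toL1 (hint g)).symm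
  classical
  refine ⟨fun f => if h : Integrable f ν then l.extendOfNorm e (h.toL1 f) else 0, ?_, ?_, ?_, ?_⟩
  · intro f g hf hg
    simp only [hf, hg, hf.add hg, dif_pos]
    rw [← map_add, Integrable.toL1_add]
  · intro c f hf
    simp only [hf, hf.smul c, dif_pos]
    rw [← smul_eq_mul, ← map_smul]
    rfl
  · intro f hf
    simp only [hf, dif_pos]
    refine le_trans ?_ (Integrable.enorm_toL1 hf).le
    rw [← ofReal_norm, ← ofReal_norm]
    refine ENNReal.ofReal_le_ofReal ?_
    simpa using LinearMap.norm_extendOfNorm_apply_le hdense 1 hnorm (hf.toL1 f)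
  · intro g
    simp only [hint g, dif_pos]
    exact LinearMap.extendOfNorm_eq hdense ⟨1, hnorm⟩ g

/-- The Radon measure `E ↦ L 1_E` of a functional `L` on `L¹(ν)`. -/
theorem exists_radonMeasure_of_integrable_functional {ν : Measure X} [IsFiniteMeasureOnCompacts ν]
    {L : (X → 𝕜) → 𝕜}
    (hadd : ∀ f g, Integrable f ν → Integrable g ν → L (f + g) = L f + L g)
    (hsmul : ∀ (c : 𝕜) f, Integrable f ν → L (c • f) = c * L f)
    (hle : ∀ f, Integrable f ν → ‖L f‖ₑ ≤ ∫⁻ x, ‖f x‖ₑ ∂ν) :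
    ∃ μ : RadonMeasure X 𝕜, μ.variation ≤ ν ∧
      ∀ f : X → 𝕜, Continuous f → HasCompactSupport f → μ.HasIntegral f (L f) := by
  classical
  have hfin : ∀ E : Set X, IsCompact (closure E) → ν E < ∞ :=
    fun E hE => (measure_mono subset_closure).trans_lt hE.measure_lt_top
  have hind : ∀ E : Set X, MeasurableSet E → IsCompact (closure E) →
      Integrable (E.indicator fun _ => (1 : 𝕜)) ν := fun E hE hE' =>
    (integrable_indicator_iff hE).2 (integrableOn_const (hfin E hE').ne)
  have hle' : ∀ E : Set X, MeasurableSet E → IsCompact (closure E) →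
      ‖L (E.indicator fun _ => (1 : 𝕜))‖ₑ ≤ ν E := by
    intro E hE hE'
    refine (hle _ (hind E hE hE')).trans_eq ?_
    simp_rw [enorm_indicator_eq_indicator_enorm]
    rw [lintegral_indicator hE]
    simp
  have hsub : ∀ f g, Integrable f ν → Integrable g ν → L (f - g) = L f - L g := by
    intro f g hf hg
    have h1 := hadd f ((-1 : 𝕜) • g) hf (hg.smul _)
    rw [hsmul _ _ hg, neg_one_smul, ← sub_eq_add_neg, neg_one_mul, ← sub_eq_add_neg] at h1
    exact h1
  let m : Set X → 𝕜 := fun E =>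
    if MeasurableSet E ∧ IsCompact (closure E) then L (E.indicator fun _ => (1 : 𝕜)) else 0
  have hm : ∀ E, MeasurableSet E → IsCompact (closure E) → m E = L (E.indicator fun _ => (1 : 𝕜)) :=
    fun E hE hE' => if_pos ⟨hE, hE'⟩
  have hunion : ∀ A B : Set X, MeasurableSet A → MeasurableSet B → Disjoint A B →
      IsCompact (closure (A ∪ B)) → m (A ∪ B) = m A + m B := by
    intro A B hA hB hAB hc
    have hcA : IsCompact (closure A) :=
      hc.of_isClosed_subset isClosed_closure (closure_mono Set.subset_union_left)
    have hcB : IsCompact (closure B) :=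
      hc.of_isClosed_subset isClosed_closure (closure_mono Set.subset_union_right)
    rw [hm _ (hA.union hB) hc, hm _ hA hcA, hm _ hB hcB,
      ← hadd _ _ (hind A hA hcA) (hind B hB hcB), Set.indicator_union_of_disjoint hAB]
    rfl
  let μ : RadonMeasure X 𝕜 := ⟨m, fun E hE => if_neg hE, fun F hF hd hc => by
    have hsubU : ∀ A ⊆ ⋃ i, F i, IsCompact (closure A) := fun A hA =>
      hc.of_isClosed_subset isClosed_closure (closure_mono hA)
    have hmF : MeasurableSet (⋃ i, F i) := MeasurableSet.iUnion hF
    have hsum : ∀ s : Finset ℕ, ∑ i ∈ s, m (F i) = m (⋃ i ∈ s, F i) := by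
      intro s
      induction s using Finset.induction_on with
      | empty =>
        have h0 := hunion ∅ ∅ .empty .empty (Set.disjoint_empty _) (by simp)
        simp only [Set.union_empty, left_eq_add] at h0
        simp [h0]
      | insert a s ha ih =>
        rw [Finset.sum_insert ha, ih, Finset.set_biUnion_insert, hunion]
        · exact hF a
        · exact .biUnion s.countable_toSet fun i _ => hF i
        · rw [Set.disjoint_iUnion₂_right]
          exact fun i hi => hd fun h => ha (h ▸ hi)
        · exact hsubU _ (Set.union_subset (Set.subset_iUnion F a)
            (Set.iUnion₂_subset fun i _ => Set.subset_iUnion F i))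
    have htail : ∀ s : Finset ℕ,
        edist (∑ i ∈ s, m (F i)) (m (⋃ i, F i)) ≤ ∑' i : { i // i ∉ s }, ν (F i) := by
      intro s
      have hms : MeasurableSet (⋃ i ∈ s, F i) := .biUnion s.countable_toSet fun i _ => hF i
      have hss : ⋃ i ∈ s, F i ⊆ ⋃ i, F i := Set.iUnion₂_subset fun i _ => Set.subset_iUnion F i
      have h1 := hunion _ _ hms (hmF.diff hms) Set.disjoint_sdiff_right
        (by rwa [Set.union_sdiff_cancel hss])
      rw [Set.union_sdiff_cancel hss] at h1
      rw [hsum, edist_comm, edist_eq_enorm_sub, h1, add_sub_cancel_left,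
        hm _ (hmF.diff hms) (hsubU _ Set.sdiff_subset)]
      refine (hle' _ (hmF.diff hms) (hsubU _ Set.sdiff_subset)).trans ?_
      refine (measure_mono ?_).trans (measure_iUnion_le fun i : { i // i ∉ s } => F i)
      rintro x ⟨hx, hx'⟩
      obtain ⟨i, hi⟩ := Set.mem_iUnion.1 hx
      exact Set.mem_iUnion.2 ⟨⟨i, fun h => hx' (Set.mem_iUnion₂.2 ⟨i, h, hi⟩)⟩, hi⟩
    have hfinsum : ∑' i, ν (F i) ≠ ∞ := by
      rw [← measure_iUnion hd hF]
      exact (hfin _ hc).ne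
    rw [HasSum, tendsto_iff_edist_tendsto_0]
    exact tendsto_of_tendsto_of_tendsto_of_le_of_le tendsto_const_nhds
      (ENNReal.tendsto_tsum_compl_atTop_zero hfinsum) (fun _ => zero_le) htail⟩
  have hvar : μ.variation ≤ ν := RadonMeasure.variation_le μ fun E hE hE' =>
    (congrArg enorm (hm E hE hE')).le.trans (hle' E hE hE')
  have hμC : ∀ C : Compacts X, μ.variation C ≠ ∞ := fun C =>
    ((hvar C).trans_lt C.isCompact.measure_lt_top).ne
  refine ⟨μ, hvar, fun f hfc hfs => ?_⟩
  have hfi : Integrable f ν := hfc.integrable_of_hasCompactSupport hfs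
  refine ⟨hfi.mono_measure hvar, tendsto_const_nhds.congr' ?_⟩
  filter_upwards [Ici_mem_atTop (⟨tsupport f, hfs⟩ : Compacts X)] with C hC
  have hCm : MeasurableSet (C : Set X) := C.isCompact.measurableSet
  have hfC : (C : Set X).indicator f = f :=
    Set.indicator_eq_self.2 ((subset_tsupport f).trans hC)
  rw [← hfC]
  conv_rhs => rw [hfC]
  refine eq_of_eq_indicator (ν := ν) 1 (A := fun f => L ((C : Set X).indicator f))
    (B := fun f => ∫ᵛ x, f x ∂[ContinuousLinearMap.mul ℝ 𝕜; μ.restr C])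
    (fun f g hf hg => ?_) (fun f g hf hg => ?_) (fun f g hf hg => ?_) (fun f g hf hg => ?_)
    (fun a s hs _ => ?_) hfi
  · rw [Set.indicator_add', hadd _ _ (hf.indicator hCm) (hg.indicator hCm)]
  · exact VectorMeasure.integral_add (RadonMeasure.integrable_restr (hf.mono_measure hvar) C)
      (RadonMeasure.integrable_restr (hg.mono_measure hvar) C)
  · rw [← hsub _ _ (hf.indicator hCm) (hg.indicator hCm), ← Set.indicator_sub', ENNReal.coe_one,
      one_mul]
    refine (hle _ ((hf.sub hg).indicator hCm)).trans (lintegral_mono fun x => ?_)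
    exact enorm_indicator_le_enorm_self _ _
  · rw [← VectorMeasure.integral_fun_sub
      (RadonMeasure.integrable_restr (hf.mono_measure hvar) C)
      (RadonMeasure.integrable_restr (hg.mono_measure hvar) C), ENNReal.coe_one, one_mul]
    exact (RadonMeasure.enorm_integral_restr_le μ _ C).trans
      (lintegral_mono' (Measure.restrict_le_self.trans hvar) le_rfl)
  · have hcl : IsCompact (closure (s ∩ C)) := C.isCompact.closure_of_subset Set.inter_subset_right
    rw [RadonMeasure.integral_restr_indicator μ (hμC C) a hs]
    change _ = a * m (s ∩ C)
    rw [hm _ (hs.inter hCm) hcl, ← hsmul _ _ (hind _ (hs.inter hCm) hcl)]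
    congr 1
    ext x
    by_cases h1 : x ∈ s <;> by_cases h2 : x ∈ (C : Set X) <;> simp [h1, h2]

/-- **Riesz representation** for order bounded functionals on `C_c(X, 𝕜)`: such a functional is the
integration with respect to a Radon measure whose variation is bounded by the Riesz measure of the
total variation of the functional. -/
theorem exists_radonMeasure_of_orderBounded [LocallyCompactSpace X] [NormalSpace X]
    {l : C_c(X, 𝕜) →ₗ[𝕜] 𝕜} (hl : OrderBounded l) : ∃ μ : RadonMeasure X 𝕜,
      μ.variation ≤ NNRealRMK.rieszMeasure (absFunctional l hl) ∧
        ∀ f : C_c(X, 𝕜), μ.HasIntegral f (l f) := by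
  obtain ⟨L, h1, h2, h3, h4⟩ := exists_extension_integrable l (enorm_le_lintegral_rieszMeasure hl)
  obtain ⟨μ, hμ, hμ'⟩ := exists_radonMeasure_of_integrable_functional h1 h2 h3
  exact ⟨μ, hμ, fun f => h4 f ▸ hμ' f (map_continuous f) f.hasCompactSupport⟩

end Riesz

/-! ### The functional `l_μ` -/

section Pairing

open scoped NNReal CompactlySupported

variable {n : ℕ} {𝕜 : Type*} [RCLike 𝕜]

instance : LocallyCompactSpace (HalfSpace n) :=
  have : LocallyCompactSpace (Set.Ioi (0 : ℝ)) :=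
    isOpen_Ioi.isOpenEmbedding_subtypeVal.locallyCompactSpace
  inferInstance

/-- A Radon measure with locally finite variation that annihilates `C_c` vanishes: indicators are
limits of functions in `C_c` in the `L¹`-norm of the variation. -/
theorem RadonMeasure.eq_zero_of_hasIntegral_zero {X : Type*} [TopologicalSpace X]
    [MeasurableSpace X] [T2Space X] [BorelSpace X] [LocallyCompactSpace X] [SigmaCompactSpace X]
    [PseudoMetrizableSpace X] {μ : RadonMeasure X 𝕜} (hμ : ∀ C : Compacts X, μ.variation C ≠ ∞)
    (h : ∀ f : X → 𝕜, Continuous f → HasCompactSupport f → μ.HasIntegral f 0) : μ = 0 := by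
  have hfin : IsFiniteMeasureOnCompacts μ.variation := ⟨fun C hC => (hμ ⟨C, hC⟩).lt_top⟩
  have hlf : IsLocallyFiniteMeasure μ.variation :=
    isLocallyFiniteMeasure_of_isFiniteMeasureOnCompacts
  have hreg : μ.variation.Regular := inferInstance
  have hnorm : NormalSpace X := by
    let := pseudoMetrizableSpacePseudoMetric X
    infer_instance
  refine Subtype.ext (funext fun E => ?_)
  by_cases hE : MeasurableSet E ∧ IsCompact (closure E)
  · have hi := RadonMeasure.hasIntegral_indicator hμ 1 hE.1 hE.2
    rw [one_mul] at hi
    change μ.1 E = 0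
    rw [← enorm_eq_zero, ← nonpos_iff_eq_zero]
    refine le_of_forall_gt fun ε hε => ?_
    obtain ⟨δ, hδ, hδε⟩ := exists_between hε
    obtain ⟨g, hgs, hg, hgc, -⟩ := hi.1.exists_hasCompactSupport_lintegral_sub_le hδ.ne'
    have h1 := (hi.sub (h g hgc hgs)).enorm_le
    rw [sub_zero] at h1
    exact (h1.trans hg).trans_lt hδε
  · exact μ.2.1 E hE

variable {S : Set (EuclideanSpace ℝ (Fin n))}

theorem isOpen_open_cone (hcont : Continuous (gauge S)) (x : EuclideanSpace ℝ (Fin n)) :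
    IsOpen {p : HalfSpace n | gauge S (x - p.1) < p.2} :=
  isOpen_lt (hcont.comp (by fun_prop)) (by fun_prop)

/-- If almost all cones have measure at most `M < ∞`, then compact sets have finite measure: the
open cones with vertex in a dense set cover the half-space. -/
theorem measure_isCompact_lt_top (hcont : Continuous (gauge S)) {ν : Measure (HalfSpace n)}
    {M : ℝ≥0∞} (hMt : M ≠ ∞) (hM : ∀ᵐ x, ν (cone S x) ≤ M) {C : Set (HalfSpace n)}
    (hC : IsCompact C) : ν C < ∞ := by
  refine hC.measure_lt_top_of_nhdsWithin fun p _ => ?_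
  have hopen : IsOpen {x : EuclideanSpace ℝ (Fin n) | gauge S (x - p.1) < p.2} :=
    isOpen_lt (hcont.comp (by fun_prop)) continuous_const
  have hd : Dense {x | ν (cone S x) ≤ M} := Measure.dense_of_ae hM
  obtain ⟨x, hx1, hx2⟩ := hd.inter_open_nonempty _ hopen ⟨p.1, by
    simpa [gauge_zero] using Set.mem_Ioi.1 p.2.2⟩
  refine ⟨_, mem_nhdsWithin_of_mem_nhds ((isOpen_open_cone hcont x).mem_nhds hx1), ?_⟩
  refine (measure_mono fun q hq => ?_).trans_lt (hx2.trans_lt hMt.lt_top)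
  exact (show gauge S (x - q.1) < q.2 from hq).le

theorem T1.ae_le (μ : T1 𝕜 S) : ∀ᵐ x, μ.1.variation (cone S x) ≤ t1ENorm S μ.1 := ae_le_essSup

section ConvexBody

variable (K : ConvexBody (EuclideanSpace ℝ (Fin n)))
  (hK : (interior (K : Set (EuclideanSpace ℝ (Fin n)))).Nonempty) (hsymm : ∀ x ∈ K, -x ∈ K)

include hK hsymm in
theorem continuous_gauge_convexBody : Continuous (gauge (K : Set (EuclideanSpace ℝ (Fin n)))) :=
  continuous_gauge K.convex (mem_nhds_zero_of_symm K.convex hK hsymm)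

include hK hsymm in
theorem T1.variation_compacts_ne_top (μ : T1 𝕜 (K : Set (EuclideanSpace ℝ (Fin n))))
    (C : Compacts (HalfSpace n)) : μ.1.variation C ≠ ∞ :=
  (measure_isCompact_lt_top (continuous_gauge_convexBody K hK hsymm) μ.2.ne (T1.ae_le μ)
    C.isCompact).ne

include hK hsymm in
theorem T1.lintegral_enorm_le (μ : T1 𝕜 (K : Set (EuclideanSpace ℝ (Fin n))))
    (f : S1 𝕜 (K : Set (EuclideanSpace ℝ (Fin n)))) :
    ∫⁻ p, ‖f p‖ₑ ∂μ.1.variation ≤ 8 ^ n * (t1ENorm K μ.1 * s1ENorm K f) := by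
  have hdir : Directed (· ⊆ ·) (compactCovering (HalfSpace n)) :=
    directed_of_isDirected_le fun _ _ h => compactCovering_subset _ h
  rw [← setLIntegral_univ, ← iUnion_compactCovering, setLIntegral_iUnion_of_directed _ hdir]
  refine iSup_le fun k => ?_
  have hk := isCompact_compactCovering (HalfSpace n) k
  exact setLIntegral_enorm_le K.convex (mem_nhds_zero_of_symm K.convex hK hsymm) K.isCompact hsymm
    _ μ.2.ne (T1.ae_le μ) f.1.continuous hk (T1.variation_compacts_ne_top K hK hsymm μ ⟨_, hk⟩)

include hK hsymm in
theorem T1.integrable (μ : T1 𝕜 (K : Set (EuclideanSpace ℝ (Fin n))))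
    (f : S1 𝕜 (K : Set (EuclideanSpace ℝ (Fin n)))) : Integrable f μ.1.variation :=
  ⟨f.1.continuous.aestronglyMeasurable, (T1.lintegral_enorm_le K hK hsymm μ f).trans_lt
    (ENNReal.mul_lt_top (by finiteness) (ENNReal.mul_lt_top μ.2 f.2))⟩

include hK hsymm in
theorem T1.hasIntegral_integral (μ : T1 𝕜 (K : Set (EuclideanSpace ℝ (Fin n))))
    (f : S1 𝕜 (K : Set (EuclideanSpace ℝ (Fin n)))) : μ.1.HasIntegral f (μ.1.integral f) := by
  obtain ⟨I, hI⟩ := RadonMeasure.exists_hasIntegral (T1.integrable K hK hsymm μ f)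
  rwa [hI.integral_eq]

include hK hsymm in
theorem T1.norm_integral_le (μ : T1 𝕜 (K : Set (EuclideanSpace ℝ (Fin n))))
    (f : S1 𝕜 (K : Set (EuclideanSpace ℝ (Fin n)))) :
    ‖μ.1.integral f‖ ≤ 8 ^ n * ‖μ‖ * ‖f‖ := by
  have h := (T1.hasIntegral_integral K hK hsymm μ f).enorm_le.trans
    (T1.lintegral_enorm_le K hK hsymm μ f)
  have h2 := ENNReal.toReal_mono (ENNReal.mul_ne_top (by finiteness)
    (ENNReal.mul_ne_top μ.2.ne f.2.ne)) h
  rw [toReal_enorm, ENNReal.toReal_mul, ENNReal.toReal_mul, ENNReal.toReal_pow, ← mul_assoc] at h2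
  exact h2

/-- The map `μ ↦ l_μ` from `T¹(K)` to the dual of `S¹₀(K)`. -/
noncomputable def T1.functional : T1 𝕜 (K : Set (EuclideanSpace ℝ (Fin n))) →ₗ[𝕜]
    StrongDual 𝕜 (S10 𝕜 (K : Set (EuclideanSpace ℝ (Fin n)))) where
  toFun μ := LinearMap.mkContinuous
    { toFun := fun f => μ.1.integral f.1
      map_add' := fun f g => ((T1.hasIntegral_integral K hK hsymm μ f.1).add
        (T1.hasIntegral_integral K hK hsymm μ g.1)).integral_eq
      map_smul' := fun c f => ((T1.hasIntegral_integral K hK hsymm μ f.1).smul c).integral_eq }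
    (8 ^ n * ‖μ‖) (fun f => T1.norm_integral_le K hK hsymm μ f.1)
  map_add' μ ν := ContinuousLinearMap.ext fun f =>
    ((T1.hasIntegral_integral K hK hsymm μ f.1).add_measure
      (T1.hasIntegral_integral K hK hsymm ν f.1)).integral_eq
  map_smul' c μ := ContinuousLinearMap.ext fun f =>
    ((T1.hasIntegral_integral K hK hsymm μ f.1).smul_measure
      (T1.variation_compacts_ne_top K hK hsymm μ) c).integral_eq

theorem T1.functional_apply (μ : T1 𝕜 (K : Set (EuclideanSpace ℝ (Fin n))))
    (f : S10 𝕜 (K : Set (EuclideanSpace ℝ (Fin n)))) :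
    T1.functional K hK hsymm μ f = μ.1.integral f.1 := rfl

theorem T1.norm_functional_le (μ : T1 𝕜 (K : Set (EuclideanSpace ℝ (Fin n)))) :
    ‖T1.functional K hK hsymm μ‖ ≤ 8 ^ n * ‖μ‖ :=
  ContinuousLinearMap.opNorm_le_bound _ (mul_nonneg (by positivity) ENNReal.toReal_nonneg)
    fun f => T1.norm_integral_le K hK hsymm μ f.1

/-- The inclusion of `C_c` into `S¹₀(K)`. -/
def ccInclusion : C_c(HalfSpace n, 𝕜) →ₗ[𝕜] S10 𝕜 (K : Set (EuclideanSpace ℝ (Fin n))) where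
  toFun g := ⟨(⟨g.toContinuousMap, mem_s1Submodule_of_hasCompactSupport K hK hsymm _
      g.hasCompactSupport⟩ : s1Submodule 𝕜 (K : Set (EuclideanSpace ℝ (Fin n)))),
    subset_closure g.hasCompactSupport⟩
  map_add' _ _ := rfl
  map_smul' _ _ := rfl

theorem denseRange_ccInclusion : DenseRange (ccInclusion (𝕜 := 𝕜) K hK hsymm) := by
  intro f
  refine closure_subtype.2 (closure_mono ?_ f.2)
  intro g hg
  exact ⟨ccInclusion K hK hsymm ⟨g.1, hg⟩, ⟨_, rfl⟩, rfl⟩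

theorem T1.functional_injective : Function.Injective (T1.functional (𝕜 := 𝕜) K hK hsymm) := by
  refine (injective_iff_map_eq_zero _).2 fun μ hμ => Subtype.ext ?_
  refine RadonMeasure.eq_zero_of_hasIntegral_zero (T1.variation_compacts_ne_top K hK hsymm μ)
    fun f hf hfs => ?_
  have h := T1.hasIntegral_integral K hK hsymm μ (ccInclusion K hK hsymm ⟨⟨f, hf⟩, hfs⟩).1
  rwa [← T1.functional_apply K hK hsymm, hμ] at h

end ConvexBody

end Pairing

/-! ### Every functional is integration with respect to a measure in `T¹(K)` -/

section Surjectivity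

open scoped NNReal CompactlySupported

variable {n : ℕ} {𝕜 : Type*} [RCLike 𝕜]

theorem s1ENorm_mono (S : Set (EuclideanSpace ℝ (Fin n))) {f g : HalfSpace n → 𝕜}
    (h : ∀ p, ‖f p‖ₑ ≤ ‖g p‖ₑ) : s1ENorm S f ≤ s1ENorm S g :=
  iSup₂_mono fun _ _ => Finset.sum_le_sum fun p _ => h p

/-- All balls in the cone `Γ_x` contain `x`, so a disjoint collection contains at most one. -/
theorem s1ENorm_le_one_of_support_subset_cone {S : Set (EuclideanSpace ℝ (Fin n))}
    {f : HalfSpace n → 𝕜} (x : EuclideanSpace ℝ (Fin n)) (hf : ∀ p, ‖f p‖ₑ ≤ 1)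
    (hx : ∀ p, f p ≠ 0 → p ∈ cone S x) : s1ENorm S f ≤ 1 := by
  refine iSup₂_le fun C hC => ?_
  by_cases h : ∃ p ∈ C, f p ≠ 0
  · obtain ⟨p, hp, hfp⟩ := h
    rw [Finset.sum_eq_single_of_mem p hp]
    · exact hf p
    · intro q hq hqp
      by_contra hfq
      have hfq' : f q ≠ 0 := fun h => hfq (by simp [h])
      exact Set.disjoint_left.1 (hC hq hp hqp) (hx q hfq') (hx p hfp)
  · push Not at h
    rw [Finset.sum_eq_zero fun p hp => by simp [h p hp]]
    exact zero_le

variable (K : ConvexBody (EuclideanSpace ℝ (Fin n)))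
  (hK : (interior (K : Set (EuclideanSpace ℝ (Fin n)))).Nonempty) (hsymm : ∀ x ∈ K, -x ∈ K)
  (l : StrongDual 𝕜 (S10 𝕜 (K : Set (EuclideanSpace ℝ (Fin n)))))

/-- The restriction to `C_c` of a functional on `S¹₀(K)`. -/
noncomputable def restrictCc : C_c(HalfSpace n, 𝕜) →ₗ[𝕜] 𝕜 :=
  l.toLinearMap ∘ₗ ccInclusion K hK hsymm

theorem nnnorm_restrictCc_le (g : C_c(HalfSpace n, 𝕜)) :
    ‖restrictCc K hK hsymm l g‖₊
      ≤ ‖l‖₊ * (s1ENorm (K : Set (EuclideanSpace ℝ (Fin n))) g).toNNReal :=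
  l.le_opNNNorm (ccInclusion K hK hsymm g)

include hK hsymm in
theorem s1ENorm_ne_top (g : C_c(HalfSpace n, 𝕜)) :
    s1ENorm (K : Set (EuclideanSpace ℝ (Fin n))) g ≠ ∞ :=
  (ccInclusion K hK hsymm g).1.2.ne

theorem orderBounded_restrictCc : OrderBounded (restrictCc K hK hsymm l) := by
  intro f
  set F : C_c(HalfSpace n, 𝕜) := f.compLeft ⟨fun r : ℝ≥0 => ((r : ℝ) : 𝕜), by fun_prop⟩
  have hF : ∀ p, ‖F p‖ₑ = f p := fun p => by
    rw [CompactlySupportedContinuousMap.compLeft_apply (by simp)]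
    simp [← ofReal_norm]
  refine ⟨‖l‖₊ * (s1ENorm (K : Set (EuclideanSpace ℝ (Fin n))) F).toNNReal, fun g hg => ?_⟩
  refine (nnnorm_restrictCc_le K hK hsymm l g).trans ?_
  gcongr
  · exact s1ENorm_ne_top K hK hsymm F
  · exact s1ENorm_mono _ fun p => (ENNReal.coe_le_coe.2 (hg p)).trans_eq (hF p).symm

/-- The Riesz measure of the total variation of `l` gives mass at most `‖l‖` to every open cone:
functions bounded by `1` and supported in the cone have `S¹(K)`-norm at most `1`. -/
theorem rieszMeasure_open_cone_le (x : EuclideanSpace ℝ (Fin n)) :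
    NNRealRMK.rieszMeasure (absFunctional _ (orderBounded_restrictCc K hK hsymm l))
      {p : HalfSpace n | gauge (K : Set (EuclideanSpace ℝ (Fin n))) (x - p.1) < p.2} ≤ ‖l‖ₑ := by
  have hU := isOpen_open_cone (continuous_gauge_convexBody K hK hsymm) x
  rw [hU.measure_eq_iSup_isCompact]
  refine iSup₂_le fun k hkU => iSup_le fun hk => ?_
  obtain ⟨f, hf1, hfc, hfU, hf01⟩ := exists_continuousMap_one_of_isCompact_subset_isOpen hk hU hkU
  let F : C_c(HalfSpace n, ℝ≥0) := ⟨⟨fun p => (f p).toNNReal, by fun_prop⟩,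
    HasCompactSupport.comp_left (f := f) (g := Real.toNNReal) hfc Real.toNNReal_zero⟩
  have h1 := NNRealRMK.lintegral_rieszMeasure
    (absFunctional _ (orderBounded_restrictCc K hK hsymm l)) F
  calc _ = ∫⁻ p, k.indicator 1 p ∂_ := (lintegral_indicator_one hk.measurableSet).symm
    _ ≤ ∫⁻ p, F p ∂_ := lintegral_mono fun p => ?_
    _ = _ := h1
    _ ≤ ‖l‖ₑ := ENNReal.coe_le_coe.2 (absFun_le fun g hg => ?_)
  · by_cases hp : p ∈ k
    · have : F p = 1 := by
        change (f p).toNNReal = 1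
        simp [hf1 hp]
      simp [this, hp]
    · simp [hp]
  · refine (nnnorm_restrictCc_le K hK hsymm l g).trans (mul_le_of_le_one_right zero_le ?_)
    refine (ENNReal.toNNReal_mono ENNReal.one_ne_top ?_).trans_eq ENNReal.toNNReal_one
    refine s1ENorm_le_one_of_support_subset_cone x (fun p => ?_) fun p hp => ?_
    · refine (ENNReal.coe_le_coe.2 ((hg p).trans ?_) : (‖g p‖₊ : ℝ≥0∞) ≤ (1 : ℝ≥0))
      change (f p).toNNReal ≤ 1
      simpa using (hf01 p).2
    · have hfp : f p ≠ 0 := by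
        intro h0
        have h2 : ‖g p‖₊ ≤ (f p).toNNReal := hg p
        rw [h0, Real.toNNReal_zero, nonpos_iff_eq_zero, nnnorm_eq_zero] at h2
        exact hp h2
      have h3 : gauge (K : Set (EuclideanSpace ℝ (Fin n))) (x - p.1) < p.2 :=
        hfU (subset_tsupport f hfp)
      exact h3.le

/-- The boundary of almost every cone is null for the Riesz measure, so the bound on open cones
controls `‖μ‖`. -/
theorem T1.exists_functional_eq : ∃ μ : T1 𝕜 (K : Set (EuclideanSpace ℝ (Fin n))),
    ‖μ‖ ≤ ‖l‖ ∧ T1.functional K hK hsymm μ = l := by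
  obtain ⟨μ, hμ, hint⟩ :=
    exists_radonMeasure_of_orderBounded (orderBounded_restrictCc K hK hsymm l)
  set ν := NNRealRMK.rieszMeasure (absFunctional _ (orderBounded_restrictCc K hK hsymm l))
  have hcone : t1ENorm (K : Set (EuclideanSpace ℝ (Fin n))) μ ≤ ‖l‖ₑ := by
    refine essSup_le_of_ae_le _ ?_
    filter_upwards [ae_measure_gauge_eq_zero K.convex
      (mem_nhds_zero_of_symm K.convex hK hsymm) ν] with x hx
    have hsplit : cone (K : Set (EuclideanSpace ℝ (Fin n))) x ⊆
        {p : HalfSpace n | gauge (K : Set (EuclideanSpace ℝ (Fin n))) (x - p.1) < p.2} ∪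
        {p : HalfSpace n | gauge (K : Set (EuclideanSpace ℝ (Fin n))) (x - p.1) = p.2} :=
      fun p hp => (show gauge _ (x - p.1) ≤ p.2 from hp).lt_or_eq
    calc μ.variation (cone K x) ≤ ν (cone K x) := hμ _
      _ ≤ _ := (measure_mono hsplit).trans (measure_union_le _ _)
      _ ≤ ‖l‖ₑ + 0 := add_le_add (rieszMeasure_open_cone_le K hK hsymm l x) hx.le
      _ = ‖l‖ₑ := add_zero _
  refine ⟨⟨μ, hcone.trans_lt enorm_lt_top⟩, ?_, ?_⟩
  · exact (ENNReal.toReal_mono enorm_ne_top hcone).trans_eq (toReal_enorm l)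
  · refine ContinuousLinearMap.coeFn_injective ?_
    refine (denseRange_ccInclusion K hK hsymm).equalizer
      (ContinuousLinearMap.continuous _) (ContinuousLinearMap.continuous _) (funext fun g => ?_)
    exact (hint g).integral_eq

end Surjectivity

end TentSpace

/-- The dual of `S¹₀(K)` is `T¹(K)`: there is a linear bijection `Φ` from `T¹(K)` onto the dual of
`S¹₀(K)` such that `Φ μ` is the (absolutely convergent) integration with respect to `μ`, and such
that `‖Φ μ‖` is comparable to `‖μ‖_{T¹(K)}` with a constant depending only on the dimension. -/
theorem theorem2p4 (n : ℕ) :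
    ∃ c : ℝ, 0 < c ∧ ∀ (𝕜 : Type*) [RCLike 𝕜] (K : ConvexBody (EuclideanSpace ℝ (Fin n))),
      (interior (K : Set (EuclideanSpace ℝ (Fin n)))).Nonempty → (∀ x ∈ K, -x ∈ K) →
        ∃ Φ : TentSpace.T1 𝕜 (K : Set (EuclideanSpace ℝ (Fin n))) ≃ₗ[𝕜]
            StrongDual 𝕜 (TentSpace.S10 𝕜 (K : Set (EuclideanSpace ℝ (Fin n)))),
          (∀ (μ : TentSpace.T1 𝕜 (K : Set (EuclideanSpace ℝ (Fin n))))
            (f : TentSpace.S10 𝕜 (K : Set (EuclideanSpace ℝ (Fin n)))),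
            μ.1.HasIntegral f.1 (Φ μ f)) ∧
          ∀ μ : TentSpace.T1 𝕜 (K : Set (EuclideanSpace ℝ (Fin n))),
            c⁻¹ * ‖μ‖ ≤ ‖Φ μ‖ ∧ ‖Φ μ‖ ≤ c * ‖μ‖ := by
  refine ⟨8 ^ n, by positivity, fun 𝕜 _ K hK hsymm => ?_⟩
  have hinj := TentSpace.T1.functional_injective (𝕜 := 𝕜) K hK hsymm
  refine ⟨LinearEquiv.ofBijective (TentSpace.T1.functional K hK hsymm) ⟨hinj, fun l => ?_⟩,
    fun μ f => TentSpace.T1.hasIntegral_integral K hK hsymm μ f.1,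
    fun μ => ⟨?_, TentSpace.T1.norm_functional_le K hK hsymm μ⟩⟩
  · obtain ⟨μ, -, hμ⟩ := TentSpace.T1.exists_functional_eq K hK hsymm l
    exact ⟨μ, hμ⟩
  · -- The measure representing `l_μ` with the norm bound is `μ` itself, by injectivity.
    obtain ⟨μ', hle, hμ'⟩ := TentSpace.T1.exists_functional_eq K hK hsymm
      (TentSpace.T1.functional K hK hsymm μ)
    rw [hinj hμ'] at hle
    refine le_trans (mul_le_of_le_one_left ENNReal.toReal_nonneg ?_) hle
    exact inv_le_one_of_one_le₀ (one_le_pow₀ (by norm_num))
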